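/- There are a program for the unit-cost random access machine and an absolute constant $K$ with the following property. Given a vector $y = (y_1, \ldots, y_m)$ of nonnegative integers, together with its length $m$ and a nonnegative integer $n$, the program always halts and correctly decides whether there is an election with $m$ candidates and $n$ voters whose Borda score vector is $y$; for all $m, n \ge 1$ and all $y$ it does so in at most $K \cdot m^{2m+1} \cdot n$ steps, that is, in time $\mathcal{O}(m^{2m+1} \cdot n)$ (in particular, in time $f(m) \cdot n$ for a function $f$ of the number of candidates alone). Here an election with $m$ candidates and $n$ voters consists of the candidate set $\{1, \ldots, m\}$ and a sequence $v_1, \ldots, v_n$ of strict total orders (rankings) of the candidates, and its Borda score vector has the entries $\sum_{i=1}^{n} (m - \mathrm{pos}_{v_i}(c))$ for $c = 1, \ldots, m$, where $\mathrm{pos}_v(c) \in \{1, \ldots, m\}$ is the position of $c$ in $v$ (the top-ranked candidate has position $1$). The random access machine has registers $R_0, R_1, R_2, \ldots$ that hold nonnegative integers; its instructions load a constant, add, subtract (with negative results replaced by $0$), read or write a register indirectly, and jump if a register is $0$; each executed instruction counts as one step. Initially $R_0 = n$, $R_1 = m$, $R_{i+1} = y_i$ for $1 \le i \le m$, and all the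 other registers are $0$; at the end $R_0$ is $1$ for "yes" and $0$ for "no". -/

import Mathlib

/-- A preference order over the candidate set `Fin m`: a bijection that sends each candidate to its
place in the ranking, where place `0` is the top one. -/
abbrev Vote (m : ℕ) : Type := Fin m ≃ Fin m

/-- The position of candidate `c` in the vote `v`; the top-ranked candidate has position `1`, the
bottom-ranked one has position `m`. -/
def Vote.pos {m : ℕ} (v : Vote m) (c : Fin m) : ℕ := (v c : ℕ) + 1

/-- An election with candidate set `Fin m` and `n` voters: the list of the `n` votes. -/
abbrev Election (m n : ℕ) : Type := Fin n → Vote m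

/-- The Borda score of candidate `c`: each voter `i` contributes `m - pos`. The subtraction never
truncates, because positions are at most `m`. -/
def Election.borda {m n : ℕ} (E : Election m n) (c : Fin m) : ℕ :=
  ∑ i : Fin n, (m - (E i).pos c)

/-- The vector `y` is the Borda score vector of some election with `m` candidates, `n` voters. -/
def IsBordaVector {m : ℕ} (n : ℕ) (y : Fin m → ℕ) : Prop :=
  ∃ E : Election m n, E.borda = y

namespace RAM

/-- The instructions of a random access machine whose registers `R 0, R 1, R 2, …` hold natural
numbers. Arithmetic is limited to addition and (truncated) subtraction. -/
inductive Instr where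
  /-- `R i := c` -/
  | const (i c : ℕ)
  /-- `R i := R j + R k` -/
  | add (i j k : ℕ)
  /-- `R i := max (R j - R k) 0` -/
  | sub (i j k : ℕ)
  /-- `R i := R (R j)` (indirect reading) -/
  | load (i j : ℕ)
  /-- `R (R i) := R j` (indirect writing) -/
  | store (i j : ℕ)
  /-- if `R i = 0`, continue at the instruction with number `l` -/
  | jumpZero (i l : ℕ)

/-- A program is a finite list of instructions, numbered from `0`. -/
abbrev Program : Type := List Instr

/-- A configuration: the number of the next instruction, and the contents of all registers. -/
structure Config where
  pc : ℕ
  reg : ℕ → ℕ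

/-- Write the value `x` to register `i` and go on to the next instruction. -/
def Config.write (s : Config) (i x : ℕ) : Config :=
  ⟨s.pc + 1, Function.update s.reg i x⟩

/-- The effect of a single instruction. -/
def Instr.exec (s : Config) : Instr → Config
  | .const i c => s.write i c
  | .add i j k => s.write i (s.reg j + s.reg k)
  | .sub i j k => s.write i (s.reg j - s.reg k)
  | .load i j => s.write i (s.reg (s.reg j))
  | .store i j => s.write (s.reg i) (s.reg j)
  | .jumpZero i l => if s.reg i = 0 then ⟨l, s.reg⟩ else ⟨s.pc + 1, s.reg⟩

/-- The machine has halted when there is no instruction with the number `pc`. -/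
def Program.Halted (P : Program) (s : Config) : Prop := P.length ≤ s.pc

/-- One step: execute the next instruction; a halted machine stays as it is. -/
def Program.step (P : Program) (s : Config) : Config :=
  match P[s.pc]? with
  | some I => I.exec s
  | none => s

/-- Started in `s`, the program `P` halts after at most `t` executed instructions (each of them
counts as one unit of time), and then register `0` holds `out`. -/
def Program.Outputs (P : Program) (s : Config) (t out : ℕ) : Prop :=
  P.Halted (P.step^[t] s) ∧ (P.step^[t] s).reg 0 = out

/-- The initial configuration for a number `n` and a vector `y` of length `m`: register `0` holds
`n`, register `1` holds `m`, the registers from `2` on hold the entries of `y`, and all the others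
hold `0`. -/
def input {m : ℕ} (n : ℕ) (y : Fin m → ℕ) : Config where
  pc := 0
  reg
    | 0 => n
    | 1 => m
    | k + 2 => if h : k < m then y ⟨k, h⟩ else 0

end RAM

/-! An election amounts to `n` permutations assigning `0, …, m - 1` points. Counting how often
candidate `c` gets `k` points yields an `m × m` matrix of naturals with all line sums `n`, whose
rows, weighted by `k`, have the sums `y c`. Conversely, Hall's theorem splits every such matrix into
`n` permutation matrices (`isBordaVector_iff_lineSum`). The machine therefore only has to decide
whether a matrix with these line sums and row scores exists.

If `m < n`, this is a matter of majorization: `y` must be majorized by `(0, n, 2n, …)`. Necessity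
holds for all `n` (`IsBordaVector.hinge`). For sufficiency, `Hinge.isBordaVector` starts from the
diagonal matrix and moves single units of score from larger to smaller entries (`of_transfer`). Each
move is realized by a chain of exchanges between neighbouring columns (`LineSum.transfer`); the
chain exists because every column with sum `n > m` has an entry of at least `2`. The inequalities
take `O(m ^ 2)` steps to test. They also suffice when `n = 0`.

If `1 ≤ n ≤ m`, rows are added one at a time by dynamic programming, which remembers only the vector
of column sums, encoded in base `n + 1`. Carries may make different vectors share a code, but the
total `n * m` of all column sums is known, and `n, …, n` is the only vector with this total and the
code `(n + 1) ^ m - 1` (`le_sum_of_sum_mul_pow`). One row is processed as an unbounded knapsack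
whose items `D k` record the number of votes, the score and the code in three non-overlapping blocks
(`mem_keysBelow_iff`). The table costs `O(n * (n + 1) ^ m * m ^ 8)`; as `n ≤ m`, the power is at
most `3 * m ^ m`, and `m ^ 8` is absorbed by a second factor `m ^ m`.

The algorithm is written in a small structured language whose compiler preserves running times
exactly (`Exec.iterate_step`), and verified with a total-correctness logic with time bounds
(`Ensures`). -/

/-! ### Elections as matrices with constant line sums -/

/-- A square matrix of natural numbers with all row sums and column sums equal to `n`. -/
structure LineSum {m : ℕ} (n : ℕ) (X : Fin m → Fin m → ℕ) : Prop where
  row : ∀ c, ∑ k, X c k = n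
  col : ∀ k, ∑ c, X c k = n

/-- The sum of row `c` when column `k` has weight `k`. -/
def rowScore {m : ℕ} (X : Fin m → Fin m → ℕ) (c : Fin m) : ℕ := ∑ k : Fin m, (k : ℕ) * X c k

/-- Hall's condition by double counting: the rows in `s` have total mass `s.card * (n + 1)`, all of
it in the columns `N` that they meet, and these hold only `N.card * (n + 1)`. -/
theorem LineSum.exists_perm {m n : ℕ} {X : Fin m → Fin m → ℕ} (hX : LineSum (n + 1) X) :
    ∃ σ : Equiv.Perm (Fin m), ∀ c, 1 ≤ X c (σ c) := by
  obtain ⟨f, hf, hfX⟩ := (Finset.all_card_le_biUnion_card_iff_exists_injective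
    (fun c => Finset.univ.filter fun k => 1 ≤ X c k)).1 (by
      intro s
      set N := s.biUnion fun c => Finset.univ.filter fun k => 1 ≤ X c k
      have h₁ : ∀ c ∈ s, ∑ k ∈ N, X c k = n + 1 := by
        intro c hc
        rw [← hX.row c]
        refine Finset.sum_subset (Finset.subset_univ _) fun k _ hk => ?_
        by_contra h
        exact hk (Finset.mem_biUnion.2 ⟨c, hc, by simp; omega⟩)
      have h₂ : s.card * (n + 1) ≤ N.card * (n + 1) := by
        calc s.card * (n + 1) = ∑ c ∈ s, ∑ k ∈ N, X c k := by
              rw [Finset.sum_congr rfl h₁]; simp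
          _ = ∑ k ∈ N, ∑ c ∈ s, X c k := Finset.sum_comm
          _ ≤ ∑ k ∈ N, ∑ c, X c k := Finset.sum_le_sum fun k _ =>
              Finset.sum_le_sum_of_subset (Finset.subset_univ _)
          _ = N.card * (n + 1) := by simp [hX.col]
      exact Nat.le_of_mul_le_mul_right h₂ (Nat.succ_pos n))
  refine ⟨Equiv.ofBijective f (Finite.injective_iff_bijective.1 hf), fun c => ?_⟩
  simpa using hfX c

/-- The integral Birkhoff decomposition: subtracting a permutation matrix inside the support lowers
all line sums by one. -/
theorem LineSum.exists_perms {m n : ℕ} {X : Fin m → Fin m → ℕ} (hX : LineSum n X) :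
    ∃ σ : Fin n → Equiv.Perm (Fin m), ∀ c, ∑ i, (σ i c : ℕ) = rowScore X c := by
  induction n generalizing X with
  | zero =>
    refine ⟨fun _ => 1, fun c => ?_⟩
    have := hX.row c
    simp only [Finset.sum_eq_zero_iff, Finset.mem_univ, true_imp_iff] at this
    simp [rowScore, this]
  | succ n ih =>
    obtain ⟨τ, hτ⟩ := hX.exists_perm
    have key : ∀ c k, X c k = (X c k - if τ c = k then 1 else 0) + if τ c = k then 1 else 0 := by
      intro c k
      split_ifs with h
      · have := hτ c
        rw [h] at this
        omega
      · omega
    have hY : LineSum n fun c k => X c k - if τ c = k then 1 else 0 := by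
      constructor
      · intro c
        have := hX.row c
        rw [Finset.sum_congr rfl fun k _ => key c k, Finset.sum_add_distrib] at this
        simpa using this
      · intro k
        have := hX.col k
        rw [Finset.sum_congr rfl fun c _ => key c k, Finset.sum_add_distrib] at this
        simpa [← Equiv.eq_symm_apply] using this
    obtain ⟨σ, hσ⟩ := ih hY
    refine ⟨Fin.cons τ σ, fun c => ?_⟩
    rw [Fin.sum_univ_succ]
    simp only [Fin.cons_zero, Fin.cons_succ, hσ, rowScore]
    conv_rhs => rw [Finset.sum_congr rfl fun k _ => by rw [key c k, mul_add]]
    rw [Finset.sum_add_distrib]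
    simp [add_comm]

/-- Reversing a ranking turns places into points, so that a voter's contribution becomes the value
of a permutation. -/
theorem isBordaVector_iff_perms {m n : ℕ} {y : Fin m → ℕ} :
    IsBordaVector n y ↔ ∃ σ : Fin n → Equiv.Perm (Fin m), ∀ c, ∑ i, (σ i c : ℕ) = y c := by
  constructor
  · rintro ⟨E, rfl⟩
    refine ⟨fun i => (E i).trans Fin.revPerm, fun c => ?_⟩
    simp [Election.borda, Vote.pos, Fin.val_rev]
  · rintro ⟨σ, h⟩
    refine ⟨fun i => (σ i).trans Fin.revPerm, funext fun c => ?_⟩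
    rw [← h c]
    simp only [Election.borda, Vote.pos, Equiv.trans_apply, Fin.revPerm_apply, Fin.val_rev]
    exact Finset.sum_congr rfl fun i _ => by omega

theorem isBordaVector_iff_lineSum {m n : ℕ} {y : Fin m → ℕ} :
    IsBordaVector n y ↔ ∃ X, LineSum n X ∧ rowScore X = y := by
  rw [isBordaVector_iff_perms]
  constructor
  · rintro ⟨σ, h⟩
    refine ⟨fun c k => ∑ i, if σ i c = k then 1 else 0, ⟨fun c => ?_, fun k => ?_⟩,
      funext fun c => ?_⟩
    · rw [Finset.sum_comm]; simp
    · rw [Finset.sum_comm]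
      simp [← Equiv.eq_symm_apply]
    · simp only [rowScore, Finset.mul_sum, ← h]
      rw [Finset.sum_comm]
      simp
  · rintro ⟨X, hX, rfl⟩
    exact hX.exists_perms

/-! ### Moving one unit of score between rows -/

/-- `TransferRank X j d k` says that row `k` can pass a unit of score on to row `j` along `d`
exchanges between neighbouring columns. -/
def TransferRank {m : ℕ} (X : Fin m → Fin m → ℕ) (j : Fin m) : ℕ → Fin m → Prop
  | 0, k => k = j
  | d + 1, k => ∃ q, TransferRank X j d q ∧ ∃ a a' : Fin m, (a' : ℕ) = a + 1 ∧ 1 ≤ X k a' ∧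
      1 ≤ X q a ∧ (q ≠ j → 2 ≤ X q a)

/-- Rows `k` and `q` exchange an entry of column `a'` and an entry of column `a`. -/
theorem LineSum.exchange {m n : ℕ} {X : Fin m → Fin m → ℕ} (hX : LineSum n X) {k q a a' : Fin m}
    (hkq : k ≠ q) (ha : (a' : ℕ) = a + 1) (hk : 1 ≤ X k a') (hq : 1 ≤ X q a) :
    ∃ Z, LineSum n Z ∧ (∀ c, rowScore Z c + (if c = k then 1 else 0) =
        rowScore X c + (if c = q then 1 else 0)) ∧
      (∀ c, c ≠ k → c ≠ q → Z c = X c) ∧ ∀ l, X q l ≤ Z q l + if l = a then 1 else 0 := by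
  have haa : a ≠ a' := by rintro rfl; omega
  set Z : Fin m → Fin m → ℕ := fun c l =>
    (X c l + (if c = k ∧ l = a then 1 else 0) + (if c = q ∧ l = a' then 1 else 0)) -
      ((if c = k ∧ l = a' then 1 else 0) + (if c = q ∧ l = a then 1 else 0)) with hZ
  -- The truncated subtraction in `Z` is exact; every later sum is computed from this additive form.
  have key : ∀ c l, Z c l + (if c = k ∧ l = a' then 1 else 0) + (if c = q ∧ l = a then 1 else 0)
      = X c l + (if c = k ∧ l = a then 1 else 0) + (if c = q ∧ l = a' then 1 else 0) := by
    intro c l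
    have : (if c = k ∧ l = a' then 1 else 0) + (if c = q ∧ l = a then 1 else 0) ≤ X c l := by
      by_cases h₁ : c = k ∧ l = a'
      · obtain ⟨rfl, rfl⟩ := h₁
        simp [hkq, hk]
      · by_cases h₂ : c = q ∧ l = a
        · obtain ⟨rfl, rfl⟩ := h₂
          simp [hkq.symm, hq]
        · simp [h₁, h₂]
    simp only [hZ]
    omega
  refine ⟨Z, ⟨fun c => ?_, fun l => ?_⟩, fun c => ?_, fun c hck hcq => ?_, fun l => ?_⟩
  · have := Finset.sum_congr (rfl : (Finset.univ : Finset (Fin m)) = _) fun l _ => key c l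
    simp only [Finset.sum_add_distrib, hX.row] at this
    by_cases h₁ : c = k <;> by_cases h₂ : c = q <;> simp_all [hkq.symm]
  · have := Finset.sum_congr (rfl : (Finset.univ : Finset (Fin m)) = _) fun c _ => key c l
    simp only [Finset.sum_add_distrib, hX.col] at this
    by_cases h₁ : l = a <;> by_cases h₂ : l = a' <;> simp_all [haa.symm]
  · have := Finset.sum_congr (rfl : (Finset.univ : Finset (Fin m)) = _) fun l _ =>
      congrArg (fun x => (l : ℕ) * x) (key c l)
    simp only [mul_add, Finset.sum_add_distrib] at this
    change rowScore Z c + _ + _ = rowScore X c + _ + _ at this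
    by_cases h₁ : c = k <;> by_cases h₂ : c = q <;>
      simp_all [hkq.symm] <;> omega
  · funext l
    simpa [hck, hcq] using key c l
  · have := key q l
    simp only [hkq.symm, false_and, if_false, true_and] at this
    omega

/-- The chain of exchanges is carried out from row `k` towards `j`. Minimality of the rank keeps the
rows of the chain distinct, so those still to come are unchanged (`hrows`). An intermediate row
gives away one entry before passing the unit on; the clause `2 ≤ X q a` of `TransferRank` ensures
that its support does not shrink (`hk`). The last row `j` passes nothing on and needs no such
reserve. -/
theorem LineSum.transfer_of_rank {m n : ℕ} {X : Fin m → Fin m → ℕ} {j : Fin m} {d : ℕ}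
    {k : Fin m} (hd : TransferRank X j d k) (hmin : ∀ d' < d, ¬ TransferRank X j d' k)
    {X' : Fin m → Fin m → ℕ} (hX' : LineSum n X')
    (hrows : ∀ q, (∃ d' < d, TransferRank X j d' q) → X' q = X q)
    (hk : ∀ a, 1 ≤ X k a → 1 ≤ X' k a) :
    ∃ Z, LineSum n Z ∧ ∀ c, rowScore Z c + (if c = k then 1 else 0) =
      rowScore X' c + if c = j then 1 else 0 := by
  induction d generalizing k X' with
  | zero =>
    obtain rfl : k = j := hd
    exact ⟨X', hX', fun c => rfl⟩
  | succ d ih =>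
    obtain ⟨q, hq, a, a', ha, hka, hqa, hqa'⟩ := hd
    have hkq : k ≠ q := by
      rintro rfl
      exact hmin d (Nat.lt_succ_self d) hq
    have hX'q : X' q = X q := hrows q ⟨d, Nat.lt_succ_self d, hq⟩
    obtain ⟨Y, hY, hYs, hYr, hYq⟩ := hX'.exchange hkq ha (hk _ hka) (by rw [hX'q]; exact hqa)
    have hqmin : ∀ d' < d, ¬ TransferRank X j d' q := fun d' hd' h =>
      hmin (d' + 1) (by omega) ⟨q, h, a, a', ha, hka, hqa, hqa'⟩
    by_cases hqj : q = j
    · subst hqj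
      exact ⟨Y, hY, hYs⟩
    obtain ⟨Z, hZ, hZs⟩ := ih hq hqmin hY (by
        rintro p ⟨d', hd', hp⟩
        rw [hYr p (by rintro rfl; exact hmin d' (by omega) hp)
          (by rintro rfl; exact hqmin d' hd' hp)]
        exact hrows p ⟨d', by omega, hp⟩) (by
        intro l hl
        have := hYq l
        rw [hX'q] at this
        split_ifs at this with h
        · subst h
          have := hqa' hqj
          omega
        · omega)
    refine ⟨Z, hZ, fun c => ?_⟩
    have := hZs c
    have := hYs c
    omega

theorem LineSum.exists_two_le {m n : ℕ} {X : Fin m → Fin m → ℕ} (hX : LineSum n X) (hn : m < n)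
    (a : Fin m) : ∃ q, 2 ≤ X q a := by
  by_contra! h
  have : ∑ c, X c a ≤ ∑ _c : Fin m, 1 := Finset.sum_le_sum fun c _ => by have := h c; omega
  rw [hX.col] at this
  simp at this
  omega

/-- Suppose that `j` is out of reach, and let `t` be the last column in the support of row `i`.
Every column has an entry of at least `2`, so descending column by column from `t` shows that each
column up to `t` is met by a row reachable from `i`. Hence row `j` vanishes in all columns below
`t`, since an entry there could complete a chain. Then the score of `j` is at least `t * n`, and
that of `i` at most `t * n`. -/
theorem LineSum.exists_transferRank {m n : ℕ} {X : Fin m → Fin m → ℕ} (hX : LineSum n X)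
    (hn : m < n) {i j : Fin m} (hij : rowScore X j < rowScore X i) :
    ∃ d, TransferRank X j d i := by
  classical
  -- exchanges in which the receiving row keeps an entry of the column that it gives away
  let E : Fin m → Fin m → Prop := fun k q => ∃ a a' : Fin m, (a' : ℕ) = a + 1 ∧ 1 ≤ X k a' ∧
    2 ≤ X q a
  have hback : ∀ k, Relation.ReflTransGen E i k → (∃ d, TransferRank X j d k) →
      ∃ d, TransferRank X j d i := by
    intro k hk
    induction hk with
    | refl => exact id
    | tail _ h ih =>
      rintro ⟨d, hd⟩
      obtain ⟨a, a', ha, h₁, h₂⟩ := h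
      exact ih ⟨d + 1, _, hd, a, a', ha, h₁, by omega, fun _ => h₂⟩
  by_contra hcon
  have hno : ∀ k, Relation.ReflTransGen E i k → ∀ a a' : Fin m, (a' : ℕ) = a + 1 → 1 ≤ X k a' →
      X j a = 0 := by
    intro k hk a a' ha h
    by_contra h0
    exact hcon (hback k hk ⟨1, j, rfl, a, a', ha, h, by omega, fun h => absurd rfl h⟩)
  -- all values up to the largest one of row `i` occur in reachable rows
  have hdown : ∀ e : ℕ, ∀ a' a : Fin m, (a' : ℕ) = a + e → 1 ≤ X i a' →
      ∃ k, Relation.ReflTransGen E i k ∧ 1 ≤ X k a := by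
    intro e
    induction e with
    | zero =>
      intro a' a h h'
      obtain rfl : a' = a := Fin.ext h
      exact ⟨i, .refl, h'⟩
    | succ e ih =>
      intro a' a h h'
      obtain ⟨k, hk, hka⟩ := ih a' ⟨a + 1, by omega⟩ (by simp only; omega) h'
      obtain ⟨q, hq⟩ := hX.exists_two_le hn a
      exact ⟨q, hk.tail ⟨a, _, rfl, hka, hq⟩, by omega⟩
  have hzero : ∀ a a' : Fin m, a < a' → 1 ≤ X i a' → X j a = 0 := by
    intro a a' h h'
    obtain ⟨k, hk, hka⟩ := hdown (a' - (a + 1)) a' ⟨a + 1, by omega⟩ (by simp only; omega) h'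
    exact hno k hk a _ rfl hka
  have hne : (Finset.univ.filter fun a => 1 ≤ X i a).Nonempty := by
    by_contra h
    rw [Finset.not_nonempty_iff_eq_empty, Finset.filter_eq_empty_iff] at h
    have := hX.row i
    rw [Finset.sum_eq_zero fun a _ => by have := h (Finset.mem_univ a); omega] at this
    omega
  obtain ⟨t, ht, htmax⟩ := Finset.exists_max_image _ id hne
  simp only [Finset.mem_filter, Finset.mem_univ, true_and, id] at ht htmax
  have h₁ : rowScore X i ≤ t * n := by
    rw [← hX.row i, Finset.mul_sum]
    refine Finset.sum_le_sum fun a _ => ?_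
    rcases Nat.eq_zero_or_pos (X i a) with h | h
    · simp [h]
    · exact Nat.mul_le_mul_right _ (htmax a h)
  have h₂ : t * n ≤ rowScore X j := by
    rw [← hX.row j, Finset.mul_sum]
    refine Finset.sum_le_sum fun a _ => ?_
    rcases lt_or_ge a t with h | h
    · simp [hzero a t h ht]
    · exact Nat.mul_le_mul_right _ h
  omega

/-- With more voters than candidates, a unit of score can be moved from any candidate to any
candidate with a smaller score. -/
theorem LineSum.transfer {m n : ℕ} {X : Fin m → Fin m → ℕ} (hX : LineSum n X) (hn : m < n)
    {i j : Fin m} (hij : rowScore X j < rowScore X i) :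
    ∃ Z, LineSum n Z ∧ ∀ c, rowScore Z c + (if c = i then 1 else 0) =
      rowScore X c + if c = j then 1 else 0 := by
  classical
  have h := hX.exists_transferRank hn hij
  exact LineSum.transfer_of_rank (Nat.find_spec h) (fun d' hd' => Nat.find_min h hd') hX
    (fun _ _ => rfl) fun _ => id

/-! ### Majorization and elections with many voters -/

/-- The linear inequalities that hold for the Borda score vectors with `n` voters: `y` is
majorized by `(0, n, 2 * n, …)`. -/
def Hinge {m : ℕ} (n : ℕ) (y : Fin m → ℕ) : Prop :=
  (∀ k < m, ∑ c, (n * k - y c) ≤ n * ∑ i ∈ Finset.range (k + 1), i) ∧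
    ∑ c, y c = n * ∑ i ∈ Finset.range m, i

theorem sum_range_sub_eq {m k : ℕ} (hk : k < m) :
    ∑ i ∈ Finset.range m, (k - i) = ∑ i ∈ Finset.range (k + 1), i := by
  rw [← Finset.sum_range_reflect _ (k + 1)]
  refine (Finset.sum_subset (Finset.range_mono hk) fun i _ hi => ?_).symm.trans ?_
  · rw [Finset.mem_range] at hi
    omega
  · exact Finset.sum_congr rfl fun i _ => by omega

/-- The positive part is subadditive, so `n * k - y c` is at most the sum over the voters of `k - σ
i c`; for each voter these sum over `c` to `0 + 1 + … + k`. -/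
theorem IsBordaVector.hinge {m n : ℕ} {y : Fin m → ℕ} (h : IsBordaVector n y) : Hinge n y := by
  obtain ⟨σ, hσ⟩ := isBordaVector_iff_perms.1 h
  constructor
  · intro k hk
    calc ∑ c, (n * k - y c) ≤ ∑ c, ∑ i, (k - (σ i c : ℕ)) := by
          refine Finset.sum_le_sum fun c _ => ?_
          rw [← hσ c, tsub_le_iff_right, ← Finset.sum_add_distrib]
          calc n * k = ∑ _i : Fin n, k := by simp
            _ ≤ _ := Finset.sum_le_sum fun i _ => by omega
      _ = ∑ i, ∑ c, (k - (σ i c : ℕ)) := Finset.sum_comm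
      _ = ∑ _i : Fin n, ∑ c : Fin m, (k - (c : ℕ)) :=
          Finset.sum_congr rfl fun i _ => Equiv.sum_comp (σ i) fun c : Fin m => k - (c : ℕ)
      _ ≤ _ := by
          rw [Finset.sum_const, Finset.card_univ, Fintype.card_fin, smul_eq_mul,
            Fin.sum_univ_eq_sum_range (fun i => k - i), sum_range_sub_eq hk]
  · simp_rw [← hσ]
    rw [Finset.sum_comm, Finset.sum_congr rfl fun i _ =>
      Equiv.sum_comp (σ i) fun c : Fin m => (c : ℕ), Finset.sum_const, Finset.card_univ,
      Fintype.card_fin, smul_eq_mul, Fin.sum_univ_eq_sum_range (fun i => i)]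

/-- Moving units of score to smaller entries leads from `x` to every vector `y` that is sorted and
majorized by `x`. -/
theorem of_transfer {m : ℕ} {Z : (Fin m → ℕ) → Prop}
    (hZ : ∀ x x' : Fin m → ℕ, ∀ i j, Z x → x j < x i →
      (∀ c, x' c + (if c = i then 1 else 0) = x c + if c = j then 1 else 0) → Z x')
    {x y : Fin m → ℕ} (hy : Monotone y) (hx : Z x)
    (hpre : ∀ k : ℕ, ∑ c with c.val < k, x c ≤ ∑ c with c.val < k, y c)
    (hsum : ∑ c, x c = ∑ c, y c) : Z y := by
  -- The measure is the total excess of `x` over `y`. The unit goes from the first entry `i` with an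
  -- excess to an entry `j < i` with a deficit, which the prefix inequalities provide; sortedness of
  -- `y` gives `x j < y j ≤ y i < x i`. Prefixes that contain `j` but not `i` have slack, because no
  -- entry before `i` has an excess.
  induction hN : ∑ c, (x c - y c) using Nat.strong_induction_on generalizing x with
  | _ N ih =>
  by_cases hxy : ∀ c, x c ≤ y c
  · have : x = y := funext fun c =>
      (Finset.sum_eq_sum_iff_of_le fun c _ => hxy c).1 hsum c (Finset.mem_univ c)
    rwa [← this]
  push Not at hxy
  -- `i` is the first entry that is too large
  obtain ⟨i, hi, himin⟩ := Finset.exists_min_image (Finset.univ.filter fun c => y c < x c) id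
    (by obtain ⟨c, hc⟩ := hxy; exact ⟨c, by simpa using hc⟩)
  simp only [Finset.mem_filter, Finset.mem_univ, true_and, id] at hi himin
  have hle : ∀ c < i, x c ≤ y c := fun c hc => by
    by_contra h
    exact absurd (himin c (by omega)) (not_le.2 hc)
  obtain ⟨j, hj, hjlt⟩ : ∃ j < i, x j < y j := by
    by_contra! h
    have h₁ := hpre (i + 1)
    have : (Finset.univ.filter fun c : Fin m => c.val < i + 1) =
        insert i (Finset.univ.filter fun c : Fin m => c.val < i) := by
      ext c
      simp only [Finset.mem_filter, Finset.mem_univ, true_and, Finset.mem_insert, Fin.ext_iff]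
      omega
    rw [this, Finset.sum_insert (by simp), Finset.sum_insert (by simp)] at h₁
    have h₂ : ∑ c with c.val < i.val, y c ≤ ∑ c with c.val < i.val, x c :=
      Finset.sum_le_sum fun c hc => h c (by simpa using hc)
    omega
  have hij : i ≠ j := hj.ne'
  have hyij := hy hj.le
  set x' : Fin m → ℕ := fun c => x c + (if c = j then 1 else 0) - if c = i then 1 else 0 with hx'
  have key : ∀ c, x' c + (if c = i then 1 else 0) = x c + if c = j then 1 else 0 := by
    intro c
    simp only [hx']
    by_cases h : c = i
    · subst h
      simp [hij]
      omega
    · simp [h]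
  refine ih (∑ c, (x' c - y c)) ?_ (hZ x x' i j hx (by omega) key) ?_ ?_ rfl
  · rw [← hN]
    refine Finset.sum_lt_sum (fun c _ => ?_) ⟨i, Finset.mem_univ i, ?_⟩
    · have := key c
      by_cases h : c = j
      · subst h
        simp [hij.symm] at this
        omega
      · simp only [h, if_false] at this
        omega
    · have := key i
      simp [hij] at this
      omega
  · intro k
    have hk := Finset.sum_congr
      (rfl : (Finset.univ.filter fun c : Fin m => c.val < k) = _) fun c _ => key c
    rw [Finset.sum_add_distrib, Finset.sum_add_distrib] at hk
    simp only [Finset.sum_ite_eq', Finset.mem_filter, Finset.mem_univ, true_and] at hk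
    have := hpre k
    by_cases hik : i.val < k
    · have : j.val < k := lt_trans hj hik
      simp only [hik, this, if_true] at hk
      omega
    · simp only [hik, if_false] at hk
      by_cases hjk : j.val < k
      · have : ∑ c with c.val < k, x c < ∑ c with c.val < k, y c :=
          Finset.sum_lt_sum (fun c hc => hle c (by
            simp only [Finset.mem_filter, Finset.mem_univ, true_and] at hc
            exact Fin.lt_def.2 (by omega))) ⟨j, by simpa using hjk, hjlt⟩
        simp only [hjk, if_true] at hk
        omega
      · simp only [hjk, if_false] at hk
        omega
  · have := Finset.sum_congr (rfl : (Finset.univ : Finset (Fin m)) = _) fun c _ => key c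
    rw [Finset.sum_add_distrib, Finset.sum_add_distrib] at this
    simp only [Finset.sum_ite_eq', Finset.mem_univ, if_true] at this
    omega

theorem LineSum.diagonal (m n : ℕ) : LineSum n fun c k : Fin m => if c = k then n else 0 :=
  ⟨fun c => by simp, fun k => by simp⟩

theorem IsBordaVector.comp_perm {m n : ℕ} {y : Fin m → ℕ} (h : IsBordaVector n y)
    (τ : Equiv.Perm (Fin m)) : IsBordaVector n (y ∘ τ) := by
  obtain ⟨σ, hσ⟩ := isBordaVector_iff_perms.1 h
  exact isBordaVector_iff_perms.2 ⟨fun i => τ.trans (σ i), fun c => hσ (τ c)⟩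

/-- This recovers the partial-sum form of majorization from the threshold form, which can be tested
without sorting. For `s.card = k + 1` the threshold `n * k` suffices: the sum of `y` over `s` is at
least `(k + 1) * n * k` minus the bound `n * k * (k + 1) / 2`. -/
theorem Hinge.le_sum {m n : ℕ} {y : Fin m → ℕ} (h : Hinge n y) (s : Finset (Fin m)) :
    n * ∑ i ∈ Finset.range s.card, i ≤ ∑ c ∈ s, y c := by
  rcases hs : s.card with _ | k
  · simp
  have hk : k < m := by
    have := s.card_le_univ
    rw [Fintype.card_fin] at this
    omega
  have h₁ : ∑ c ∈ s, (n * k - y c) ≤ n * ∑ i ∈ Finset.range (k + 1), i :=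
    (Finset.sum_le_sum_of_subset s.subset_univ).trans (h.1 k hk)
  have h₂ : (k + 1) * (n * k) ≤ ∑ c ∈ s, (n * k - y c) + ∑ c ∈ s, y c := by
    rw [← Finset.sum_add_distrib, ← hs, ← smul_eq_mul, ← Finset.sum_const]
    exact Finset.sum_le_sum fun c _ => by omega
  have h₃ := Finset.sum_range_id_mul_two (k + 1)
  have h₄ : (k + 1) * (n * k) = n * (∑ i ∈ Finset.range (k + 1), i) * 2 := by
    rw [mul_assoc, h₃, Nat.add_sub_cancel]; ring
  omega

/-- If there are more voters than candidates, then the linear inequalities suffice. -/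
theorem Hinge.isBordaVector {m n : ℕ} {y : Fin m → ℕ} (hn : m < n) (h : Hinge n y) :
    IsBordaVector n y := by
  have main : IsBordaVector n (y ∘ Tuple.sort y) := by
    refine of_transfer (Z := IsBordaVector n) (x := fun c => n * c) ?_ (Tuple.monotone_sort y)
      ?_ ?_ ?_
    · intro x x' i j hx hij hxx'
      obtain ⟨X, hX, rfl⟩ := isBordaVector_iff_lineSum.1 hx
      obtain ⟨Y, hY, hYX⟩ := hX.transfer hn hij
      refine isBordaVector_iff_lineSum.2 ⟨Y, hY, funext fun c => ?_⟩
      have := hYX c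
      have := hxx' c
      omega
    · refine isBordaVector_iff_lineSum.2 ⟨_, LineSum.diagonal m n, funext fun c => ?_⟩
      simp [rowScore, mul_comm]
    · intro k
      have h₁ := h.le_sum ((Finset.univ.filter fun c : Fin m => c.val < k).map
        (Tuple.sort y).toEmbedding)
      rw [Finset.card_map, Finset.sum_map] at h₁
      refine le_trans (le_of_eq ?_) h₁
      rw [← Finset.mul_sum]
      congr 1
      have h₂ : (Finset.univ.filter fun c : Fin m => c.val < k).map Fin.valEmbedding =
          Finset.range (min k m) := by
        ext c
        simp only [Finset.mem_map, Finset.mem_filter, Finset.mem_univ, true_and,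
          Fin.valEmbedding_apply, Finset.mem_range, lt_min_iff]
        exact ⟨by rintro ⟨a, ha, rfl⟩; exact ⟨ha, a.2⟩, fun hc => ⟨⟨c, hc.2⟩, hc.1, rfl⟩⟩
      rw [← Finset.card_map Fin.valEmbedding, h₂, Finset.card_range, ← h₂, Finset.sum_map]
      rfl
    · rw [Function.comp_def, Equiv.sum_comp (Tuple.sort y) y, h.2, ← Finset.mul_sum,
        Fin.sum_univ_eq_sum_range (fun i => i)]
  have := main.comp_perm (Tuple.sort y)⁻¹
  convert this using 1
  funext c
  simp

theorem isBordaVector_zero_iff {m : ℕ} {y : Fin m → ℕ} : IsBordaVector 0 y ↔ Hinge 0 y := by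
  refine ⟨IsBordaVector.hinge, fun h => isBordaVector_iff_perms.2 ⟨Fin.elim0, fun c => ?_⟩⟩
  have := h.2
  simp only [zero_mul, Finset.sum_eq_zero_iff, Finset.mem_univ, true_imp_iff] at this
  simp [this c]

/-! ### Codes of column sums -/

/-- The smallest number of powers of `n + 1` with exponents below `m` that have a sum of the form
`a * (n + 1) ^ m - 1`. -/
theorem le_sum_of_sum_mul_pow {m n a : ℕ} {u : Fin m → ℕ}
    (h : ∑ k, u k * (n + 1) ^ (k : ℕ) + 1 = a * (n + 1) ^ m) :
    n * m + (a - 1) * (n + 1) ≤ ∑ k, u k ∧ (a = 1 → ∑ k, u k = n * m → ∀ k, u k = n) := by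
  induction m generalizing a with
  | zero =>
    simp only [Finset.univ_eq_empty, Finset.sum_empty, zero_add, pow_zero, mul_one] at h
    subst h
    simp
  | succ m ih =>
    rw [Fin.sum_univ_castSucc] at h
    simp only [Fin.val_castSucc, Fin.val_last] at h
    rw [Fin.sum_univ_castSucc]
    set s := ∑ k : Fin m, u k.castSucc * (n + 1) ^ (k : ℕ)
    have hpos : 0 < (n + 1) ^ m := by positivity
    -- `e` plays the role of the carry into position `m`. Each unit of `e` beyond the first costs
    -- `n` additional powers, which gives both the bound and the case of equality.
    obtain ⟨e, he⟩ : (n + 1) ^ m ∣ s + 1 := by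
      have h₁ : (n + 1) ^ m ∣ (s + 1) + u (Fin.last m) * (n + 1) ^ m :=
        ⟨a * (n + 1), by rw [add_right_comm, h]; ring⟩
      exact (Nat.dvd_add_left (dvd_mul_left _ _)).1 h₁
    obtain ⟨h₁, h₂⟩ := ih (u := fun k => u k.castSucc) (a := e) (by rw [he, mul_comm])
    have he' : e + u (Fin.last m) = a * (n + 1) := by
      apply Nat.eq_of_mul_eq_mul_left hpos
      rw [mul_add, ← he]
      calc s + 1 + (n + 1) ^ m * u (Fin.last m) = s + u (Fin.last m) * (n + 1) ^ m + 1 := by ring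
        _ = (n + 1) ^ m * (a * (n + 1)) := by rw [h]; ring
    have hepos : e ≠ 0 := by
      rintro rfl
      simp at he
    obtain ⟨e, rfl⟩ := Nat.exists_eq_succ_of_ne_zero hepos
    have hapos : a ≠ 0 := by
      rintro rfl
      simp at he'
    obtain ⟨a, rfl⟩ := Nat.exists_eq_succ_of_ne_zero hapos
    simp only [Nat.succ_eq_add_one, Nat.add_sub_cancel] at *
    constructor
    · have : n * (m + 1) = n * m + n := by ring
      have : (a + 1) * (n + 1) = a * (n + 1) + n + 1 := by ring
      have : e * (n + 1) = e * n + e := by ring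
      omega
    · intro ha hsum
      obtain rfl : a = 0 := by omega
      have h₃ : n * (m + 1) = n * m + n := by ring
      have h₄ : e * (n + 1) = e * n + e := by ring
      have hl : u (Fin.last m) = n ∨ e ≠ 0 := by omega
      rcases Nat.eq_zero_or_pos e with he0 | he0
      · subst he0
        have hl : u (Fin.last m) = n := by omega
        intro k
        refine Fin.lastCases hl (fun k => ?_) k
        exact h₂ rfl (by omega) k
      · have hn : e * n = 0 := by omega
        have hn0 : n = 0 := by
          rcases Nat.mul_eq_zero.1 hn with h | h
          · omega
          · exact h
        subst hn0
        omega

/-- The codes `∑ v k * b ^ k` of the rows `v` with sum `n` and score `w`. -/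
def rowCodes (m b n w : ℕ) : Set ℕ :=
  {q | ∃ v : Fin m → ℕ, ∑ k, v k = n ∧ ∑ k : Fin m, k * v k = w ∧
    ∑ k : Fin m, v k * b ^ (k : ℕ) = q}

/-- The codes of the column sums of the matrices with `c` rows, where row `i` has sum `n` and
score `y i`. -/
def prefixCodes (m b n : ℕ) (y : ℕ → ℕ) : ℕ → Set ℕ
  | 0 => {0}
  | c + 1 => {q | ∃ q₀ ∈ prefixCodes m b n y c, ∃ q₁ ∈ rowCodes m b n (y c), q = q₀ + q₁}

theorem mem_prefixCodes {m b n : ℕ} {y : ℕ → ℕ} {c q : ℕ} :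
    q ∈ prefixCodes m b n y c ↔ ∃ X : ℕ → Fin m → ℕ,
      (∀ i < c, ∑ k, X i k = n ∧ ∑ k : Fin m, k * X i k = y i) ∧
        ∑ i ∈ Finset.range c, ∑ k : Fin m, X i k * b ^ (k : ℕ) = q := by
  induction c generalizing q with
  | zero => simp [prefixCodes, eq_comm]
  | succ c ih =>
    simp only [prefixCodes, Set.mem_ofPred_eq]
    constructor
    · rintro ⟨q₀, h₀, _, ⟨v, hv₁, hv₂, rfl⟩, rfl⟩
      obtain ⟨X, hX, rfl⟩ := ih.1 h₀
      have hne : ∀ i < c, Function.update X c v i = X i := fun i hi =>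
        Function.update_of_ne hi.ne _ _
      refine ⟨Function.update X c v, fun i hi => ?_, ?_⟩
      · rcases Nat.lt_succ_iff_lt_or_eq.1 hi with h | rfl
        · rw [hne i h]
          exact hX i h
        · rw [Function.update_self]
          exact ⟨hv₁, hv₂⟩
      · rw [Finset.sum_range_succ, Function.update_self]
        congr 1
        exact Finset.sum_congr rfl fun i hi => by rw [hne i (Finset.mem_range.1 hi)]
    · rintro ⟨X, hX, rfl⟩
      exact ⟨_, ih.2 ⟨X, fun i hi => hX i (by omega), rfl⟩, _,
        ⟨X c, (hX c (by omega)).1, (hX c (by omega)).2, rfl⟩, Finset.sum_range_succ _ _⟩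

theorem sum_mul_pow_le {m b : ℕ} (hb : 1 ≤ b) (v : Fin m → ℕ) :
    ∑ k : Fin m, v k * b ^ (k : ℕ) ≤ (∑ k, v k) * b ^ m := by
  rw [Finset.sum_mul]
  exact Finset.sum_le_sum fun k _ => Nat.mul_le_mul_left _ (Nat.pow_le_pow_right hb k.2.le)

theorem le_of_mem_prefixCodes {m b n : ℕ} (hb : 1 ≤ b) {y : ℕ → ℕ} {c q : ℕ}
    (h : q ∈ prefixCodes m b n y c) : q ≤ c * n * b ^ m := by
  obtain ⟨X, hX, rfl⟩ := mem_prefixCodes.1 h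
  calc _ ≤ ∑ i ∈ Finset.range c, n * b ^ m := Finset.sum_le_sum fun i hi => by
        have := sum_mul_pow_le hb (X i)
        rwa [(hX i (Finset.mem_range.1 hi)).1] at this
    _ = _ := by simp [mul_assoc]

/-- The target is the code of the column sums `n, …, n`. The sum of all entries is `n * m` because
of the row sums, and this excludes any other column sums with the same code. -/
theorem isBordaVector_iff_mem_prefixCodes {m n : ℕ} {y : Fin m → ℕ} {y' : ℕ → ℕ}
    (hy : ∀ c : Fin m, y' c = y c) :
    IsBordaVector n y ↔ (n + 1) ^ m - 1 ∈ prefixCodes m (n + 1) n y' m := by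
  have hpos : 0 < (n + 1) ^ m := by positivity
  rw [isBordaVector_iff_lineSum, mem_prefixCodes]
  constructor
  · rintro ⟨X, hX, rfl⟩
    refine ⟨fun i => if h : i < m then X ⟨i, h⟩ else 0, fun i hi => ?_, ?_⟩
    · simp only [hi, dite_true]
      exact ⟨hX.row _, (hy ⟨i, hi⟩).symm⟩
    · rw [← Fin.sum_univ_eq_sum_range (fun i => ∑ k : Fin m,
        (if h : i < m then X ⟨i, h⟩ else 0) k * (n + 1) ^ (k : ℕ)), Finset.sum_comm]
      simp only [Fin.is_lt, dite_true, Fin.eta, ← Finset.sum_mul, hX.col]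
      rw [← Finset.mul_sum, Fin.sum_univ_eq_sum_range (fun k => (n + 1) ^ k)]
      have h₁ := Commute.geom_sum₂_mul (Commute.all ((n : ℤ) + 1) 1) m
      simp only [one_pow, mul_one, add_sub_cancel_right] at h₁
      zify [Nat.one_le_iff_ne_zero.2 hpos.ne']
      rw [← h₁, mul_comm]
  · rintro ⟨X, hX, hsum⟩
    rw [← Fin.sum_univ_eq_sum_range (fun i => ∑ k : Fin m, X i k * (n + 1) ^ (k : ℕ)),
      Finset.sum_comm] at hsum
    simp only [← Finset.sum_mul] at hsum
    refine ⟨fun i => X i, ⟨fun c => (hX c c.2).1, ?_⟩, funext fun c => ?_⟩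
    · refine (le_sum_of_sum_mul_pow (a := 1) (by rw [hsum]; omega)).2 rfl ?_
      rw [Finset.sum_comm, Finset.sum_congr rfl fun (i : Fin m) _ => (hX i i.2).1]
      simp [mul_comm]
    · rw [← hy c, ← (hX c c.2).2]
      rfl

/-! ### One row as an unbounded knapsack -/

/-- The sums of an element of `A` and of numbers of the form `D k`. -/
def keys {m : ℕ} (A : Set ℕ) (D : Fin m → ℕ) : Set ℕ :=
  {M | ∃ q ∈ A, ∃ v : Fin m → ℕ, M = q + ∑ k, v k * D k}

/-- The elements of `A`, and the sums of a member of `keys A D` less than `B` and a number `D k`. -/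
def keysBelow {m : ℕ} (A : Set ℕ) (D : Fin m → ℕ) (B : ℕ) : Set ℕ :=
  {M | M ∈ A ∨ ∃ k, ∃ N ∈ keys A D, N < B ∧ M = N + D k}

theorem add_mem_keys {m : ℕ} {A : Set ℕ} {D : Fin m → ℕ} {N : ℕ} (h : N ∈ keys A D) (k : Fin m) :
    N + D k ∈ keys A D := by
  obtain ⟨q, hq, v, rfl⟩ := h
  refine ⟨q, hq, v + Pi.single k 1, ?_⟩
  simp [add_mul, Finset.sum_add_distrib, Pi.single_apply, add_assoc]

theorem exists_of_mem_keys {m : ℕ} {A : Set ℕ} {D : Fin m → ℕ} {q : ℕ} (hq : q ∈ A)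
    {v : Fin m → ℕ} {k : Fin m} (hk : v k ≠ 0) :
    ∃ v' : Fin m → ℕ, v = v' + Pi.single k 1 ∧ q + ∑ k, v' k * D k ∈ keys A D ∧
      q + ∑ k, v k * D k = (q + ∑ k, v' k * D k) + D k := by
  have h : v = (v - Pi.single k 1) + Pi.single k 1 := by
    funext l
    by_cases h : l = k
    · subst h
      simp
      omega
    · simp [h]
  refine ⟨v - Pi.single k 1, h, ⟨q, hq, _, rfl⟩, ?_⟩
  conv_lhs => rw [h]
  simp only [Pi.add_apply, add_mul, Finset.sum_add_distrib]
  simp [Pi.single_apply, add_assoc]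

/-- `keysBelow A D N` is the set of nonzero cells once the cells below `N` have been visited in
increasing order. As all `D k` are positive, cell `N` is final when its turn comes. -/
theorem mem_keysBelow_self {m : ℕ} {A : Set ℕ} {D : Fin m → ℕ} (hD : ∀ k, 1 ≤ D k) {N : ℕ} :
    N ∈ keysBelow A D N ↔ N ∈ keys A D := by
  constructor
  · rintro (h | ⟨k, M, h, -, rfl⟩)
    · exact ⟨N, h, 0, by simp⟩
    · exact add_mem_keys h k
  · rintro ⟨q, hq, v, rfl⟩
    by_cases hv : v = 0
    · subst hv
      exact Or.inl (by simpa using hq)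
    · obtain ⟨k, hk⟩ := Function.ne_iff.1 hv
      obtain ⟨v', -, h₁, h₂⟩ := exists_of_mem_keys (D := D) hq hk
      exact Or.inr ⟨k, _, h₁, by have := hD k; omega, h₂⟩

theorem mem_keysBelow_succ {m : ℕ} {A : Set ℕ} {D : Fin m → ℕ} {N M : ℕ} :
    M ∈ keysBelow A D (N + 1) ↔ M ∈ keysBelow A D N ∨ (N ∈ keys A D ∧ ∃ k, M = N + D k) := by
  constructor
  · rintro (h | ⟨k, N', h₁, h₂, h₃⟩)
    · exact Or.inl (Or.inl h)
    · rcases Nat.lt_succ_iff_lt_or_eq.1 h₂ with h | rfl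
      · exact Or.inl (Or.inr ⟨k, N', h₁, h, h₃⟩)
      · exact Or.inr ⟨h₁, k, h₃⟩
  · rintro ((h | ⟨k, N', h₁, h₂, h₃⟩) | ⟨h₁, k, h₂⟩)
    · exact Or.inl h
    · exact Or.inr ⟨k, N', h₁, by omega, h₃⟩
    · exact Or.inr ⟨k, N, h₁, by omega, h₂⟩

section RowKeys

variable {m b n a C W : ℕ} {A : Set ℕ}

theorem sum_mul_key (v : Fin m → ℕ) :
    ∑ k : Fin m, v k * (C * W + k * C + b ^ (k : ℕ)) =
      (∑ k, v k) * (C * W) + (∑ k : Fin m, k * v k) * C + ∑ k : Fin m, v k * b ^ (k : ℕ) := by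
  simp only [Finset.sum_mul, ← Finset.sum_add_distrib]
  exact Finset.sum_congr rfl fun k _ => by ring

theorem sum_id_mul_le (v : Fin m → ℕ) : ∑ k : Fin m, k * v k ≤ (∑ k, v k) * m := by
  rw [Finset.sum_mul]
  refine Finset.sum_le_sum fun k _ => ?_
  rw [mul_comm]
  exact Nat.mul_le_mul_left _ k.2.le

theorem mul_add_lt {w q : ℕ} (hw : w < W) (hq : q < C) : w * C + q < C * W := by
  calc w * C + q < w * C + C := by omega
    _ = C * (w + 1) := by ring
    _ ≤ C * W := Nat.mul_le_mul_left _ hw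

theorem eq_of_mul_add_eq {w w' q q' : ℕ} (hq : q < C) (hq' : q' < C)
    (h : w * C + q = w' * C + q') : w = w' ∧ q = q' := by
  have hC : 0 < C := by omega
  have h₁ := congrArg (· / C) h
  have h₂ := congrArg (· % C) h
  simp only [Nat.mul_add_mod_of_lt hq, Nat.mul_add_mod_of_lt hq'] at h₂
  simp only [mul_comm _ C, Nat.mul_add_div hC, Nat.div_eq_of_lt hq, Nat.div_eq_of_lt hq'] at h₁
  exact ⟨by simpa using h₁, h₂⟩

/-- Each summand contributes at least `C * W`, so a key below `n * (C * W)` has fewer than `n` of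
them, and one further push leads to at most `n`. -/
theorem exists_of_mem_keysBelow {M : ℕ}
    (h : M ∈ keysBelow A (fun k : Fin m => C * W + k * C + b ^ (k : ℕ)) (n * (C * W))) :
    ∃ q ∈ A, ∃ v : Fin m → ℕ, ∑ k, v k ≤ n ∧
      M = (∑ k, v k) * (C * W) + ((∑ k : Fin m, k * v k) * C +
        (q + ∑ k : Fin m, v k * b ^ (k : ℕ))) := by
  rcases h with h | ⟨k, N, ⟨q, hq, v, rfl⟩, hlt, rfl⟩
  · exact ⟨M, h, 0, by simp, by simp⟩
  · refine ⟨q, hq, v + Pi.single k 1, ?_, ?_⟩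
    · rw [sum_mul_key] at hlt
      have : (∑ k, v k) * (C * W) < n * (C * W) := by omega
      have := Nat.lt_of_mul_lt_mul_right this
      simp [Finset.sum_add_distrib, Pi.single_apply]
      omega
    · have := sum_mul_key (b := b) (C := C) (W := W) (v + Pi.single k 1)
      rw [show ∀ x y z w : ℕ, x + (y + (z + w)) = z + (x + y + w) by intros; ring, ← this]
      simp [add_mul, Finset.sum_add_distrib, Pi.single_apply]
      ring

variable (hb : 1 ≤ b) (hA : ∀ q ∈ A, q ≤ a) (hC : a + n * b ^ m < C) (hW : n * m < W)
include hb hA hC hW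

/-- A key with at most `n` summands consists of three blocks that do not overlap. -/
theorem row_key_lt {q : ℕ} (hq : q ∈ A) {v : Fin m → ℕ} (hv : ∑ k, v k ≤ n) :
    ∑ k : Fin m, k * v k < W ∧ q + ∑ k : Fin m, v k * b ^ (k : ℕ) < C := by
  constructor
  · exact ((sum_id_mul_le v).trans (Nat.mul_le_mul_right _ hv)).trans_lt hW
  · have h₁ := hA q hq
    have h₂ := (sum_mul_pow_le hb v).trans (Nat.mul_le_mul_right _ hv)
    omega

theorem lt_of_mem_keysBelow {M : ℕ}
    (h : M ∈ keysBelow A (fun k : Fin m => C * W + k * C + b ^ (k : ℕ)) (n * (C * W))) :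
    M < (n + 1) * (C * W) := by
  obtain ⟨q, hq, v, hv, rfl⟩ := exists_of_mem_keysBelow h
  obtain ⟨h₁, h₂⟩ := row_key_lt hb hA hC hW hq hv
  have h₃ := mul_add_lt h₁ h₂
  have h₄ := Nat.mul_le_mul_right (C * W) hv
  rw [Nat.succ_mul]
  omega

/-- Since the blocks do not overlap, number of votes, score and code can be read off separately:
layer `n`, block `w` holds exactly the codes extended by a row of sum `n` and score `w`. -/
theorem mem_keysBelow_iff (hn : 1 ≤ n) {w q : ℕ} (hw : w < W) (hq : q < C) :
    n * (C * W) + (w * C + q) ∈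
        keysBelow A (fun k : Fin m => C * W + k * C + b ^ (k : ℕ)) (n * (C * W)) ↔
      ∃ q₀ ∈ A, ∃ q₁ ∈ rowCodes m b n w, q = q₀ + q₁ := by
  constructor
  · intro h
    obtain ⟨q₀, hq₀, v, hv, he⟩ := exists_of_mem_keysBelow h
    obtain ⟨h₁, h₂⟩ := row_key_lt hb hA hC hW hq₀ hv
    obtain ⟨e₁, e₂⟩ := eq_of_mul_add_eq (mul_add_lt hw hq) (mul_add_lt h₁ h₂) he
    obtain ⟨e₃, e₄⟩ := eq_of_mul_add_eq hq h₂ e₂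
    exact ⟨q₀, hq₀, _, ⟨v, e₁.symm, e₃.symm, rfl⟩, e₄⟩
  · rintro ⟨q₀, hq₀, _, ⟨v, hv₁, hv₂, rfl⟩, rfl⟩
    obtain ⟨k, hk⟩ : ∃ k, v k ≠ 0 := by
      by_contra! h
      rw [Finset.sum_eq_zero fun k _ => h k] at hv₁
      omega
    obtain ⟨v', rfl, h₁, h₂⟩ :=
      exists_of_mem_keys (D := fun k : Fin m => C * W + k * C + b ^ (k : ℕ)) hq₀ hk
    refine Or.inr ⟨k, _, h₁, ?_, ?_⟩
    · have hv' : ∑ k, v' k + 1 = n := by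
        simpa [Finset.sum_add_distrib, Pi.single_apply] using hv₁
      obtain ⟨h₃, h₄⟩ := row_key_lt hb hA hC hW hq₀ (v := v') (by omega)
      have h₅ := mul_add_lt h₃ h₄
      rw [sum_mul_key, ← hv', Nat.succ_mul]
      omega
    · rw [← h₂, sum_mul_key, hv₁, hv₂]
      ring

end RowKeys

/-! ### Growth estimates -/

/-- `(1 + 1 / m) ^ m ≤ e < 3`. -/
theorem succ_pow_self_le (m : ℕ) : (m + 1) ^ m ≤ 3 * m ^ m := by
  rcases Nat.eq_zero_or_pos m with rfl | hm
  · simp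
  have hm' : (0 : ℝ) < m := by exact_mod_cast hm
  have h₁ : (1 + 1 / (m : ℝ)) ^ m ≤ 3 := by
    calc (1 + 1 / (m : ℝ)) ^ m ≤ Real.exp (1 / m) ^ m := by
          refine pow_le_pow_left₀ (by positivity) ?_ m
          rw [add_comm]
          exact Real.add_one_le_exp _
      _ = Real.exp 1 := by
          rw [← Real.exp_nat_mul]
          congr 1
          field_simp
      _ ≤ 3 := by linarith [Real.exp_one_lt_d9]
  have h₂ : ((m : ℝ) + 1) ^ m ≤ 3 * (m : ℝ) ^ m := by
    calc ((m : ℝ) + 1) ^ m = ((1 + 1 / (m : ℝ)) * m) ^ m := by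
          congr 1
          field_simp
      _ = (1 + 1 / (m : ℝ)) ^ m * (m : ℝ) ^ m := mul_pow _ _ _
      _ ≤ 3 * (m : ℝ) ^ m := by gcongr
  exact_mod_cast h₂

theorem pow_le_const_mul_pow_self (e m : ℕ) (hm : 1 ≤ m) : m ^ e ≤ e ^ e * m ^ m := by
  rcases le_total m e with h | h
  · calc m ^ e ≤ e ^ e := Nat.pow_le_pow_left h e
      _ ≤ e ^ e * m ^ m := Nat.le_mul_of_pos_right _ (by positivity)
  · calc m ^ e ≤ m ^ m := Nat.pow_le_pow_right hm h
      _ ≤ e ^ e * m ^ m := by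
          rcases Nat.eq_zero_or_pos e with rfl | he
          · simp
          · exact Nat.le_mul_of_pos_left _ (by positivity)

/-! ### A structured language and its compiler -/

namespace RAM

/-- Structured commands, compiled to straight code with forward and backward jumps. -/
inductive Cmd where
  | const (i c : ℕ)
  | add (i j k : ℕ)
  | sub (i j k : ℕ)
  | load (i j : ℕ)
  | store (i j : ℕ)
  | seq (c d : Cmd)
  /-- Execute `c` unless register `i` is zero. -/
  | cond (i : ℕ) (c : Cmd)
  /-- Execute `c`, and repeat this as long as register `i` is zero afterwards. -/
  | loop (c : Cmd) (i : ℕ)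

infixr:60 " ;; " => Cmd.seq

/-- The number of instructions of a compiled command. -/
def Cmd.size : Cmd → ℕ
  | .seq c d => c.size + d.size
  | .cond _ c => c.size + 1
  | .loop c _ => c.size + 1
  | _ => 1

/-- The code of a command that is placed at the program address `a`. -/
def Cmd.compile : Cmd → ℕ → Program
  | .const i c, _ => [.const i c]
  | .add i j k, _ => [.add i j k]
  | .sub i j k, _ => [.sub i j k]
  | .load i j, _ => [.load i j]
  | .store i j, _ => [.store i j]
  | .seq c d, a => c.compile a ++ d.compile (a + c.size)
  | .cond i c, a => .jumpZero i (a + 1 + c.size) :: c.compile (a + 1)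
  | .loop c i, a => c.compile a ++ [.jumpZero i a]

theorem Cmd.length_compile (c : Cmd) (a : ℕ) : (c.compile a).length = c.size := by
  induction c generalizing a <;> simp_all [Cmd.compile, Cmd.size]

/-- Big-step semantics with exact running time. -/
inductive Exec : Cmd → (ℕ → ℕ) → ℕ → (ℕ → ℕ) → Prop
  | const (i c r) : Exec (.const i c) r 1 (Function.update r i c)
  | add (i j k r) : Exec (.add i j k) r 1 (Function.update r i (r j + r k))
  | sub (i j k r) : Exec (.sub i j k) r 1 (Function.update r i (r j - r k))
  | load (i j r) : Exec (.load i j) r 1 (Function.update r i (r (r j)))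
  | store (i j r) : Exec (.store i j) r 1 (Function.update r (r i) (r j))
  | seq {c d r s r' s' r''} : Exec c r s r' → Exec d r' s' r'' → Exec (.seq c d) r (s + s') r''
  | cond_zero {i c r} : r i = 0 → Exec (.cond i c) r 1 r
  | cond_pos {i c r s r'} : r i ≠ 0 → Exec c r s r' → Exec (.cond i c) r (s + 1) r'
  | loop_last {i c r s r'} : Exec c r s r' → r' i ≠ 0 → Exec (.loop c i) r (s + 1) r'
  | loop_next {i c r s r' s' r''} : Exec c r s r' → r' i = 0 → Exec (.loop c i) r' s' r'' →
      Exec (.loop c i) r (s + 1 + s') r''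

/-- The code `Q` stands in the program `P` at the address `a`. -/
def Program.CodeAt (P : Program) (a : ℕ) (Q : Program) : Prop :=
  ∃ l₁ l₂, P = l₁ ++ Q ++ l₂ ∧ l₁.length = a

theorem Program.CodeAt.left {P : Program} {a : ℕ} {Q R : Program} (h : P.CodeAt a (Q ++ R)) :
    P.CodeAt a Q := by
  obtain ⟨l₁, l₂, rfl, h⟩ := h
  exact ⟨l₁, R ++ l₂, by simp, h⟩

theorem Program.CodeAt.right {P : Program} {a : ℕ} {Q R : Program} (h : P.CodeAt a (Q ++ R)) :
    P.CodeAt (a + Q.length) R := by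
  obtain ⟨l₁, l₂, rfl, h⟩ := h
  exact ⟨l₁ ++ Q, l₂, by simp, by simp [h]⟩

theorem Program.CodeAt.step {P : Program} {a : ℕ} {I : Instr} {Q : Program}
    (h : P.CodeAt a (I :: Q)) (r : ℕ → ℕ) : P.step ⟨a, r⟩ = I.exec ⟨a, r⟩ := by
  obtain ⟨l₁, l₂, rfl, rfl⟩ := h
  simp [Program.step]

/-- Correctness of the compiler, by induction on the derivation. Jump targets are absolute, so the
address `a` of the code must agree with the address it was compiled for. -/
theorem Exec.iterate_step {c : Cmd} {r r' : ℕ → ℕ} {t : ℕ} (h : Exec c r t r') {P : Program}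
    {a : ℕ} (hP : P.CodeAt a (c.compile a)) :
    P.step^[t] ⟨a, r⟩ = ⟨a + c.size, r'⟩ := by
  induction h generalizing a with
  | const | add | sub | load | store =>
    simpa [Cmd.size, Instr.exec, Config.write] using hP.step _
  | seq _ _ ih₁ ih₂ =>
    rw [add_comm, Function.iterate_add_apply, ih₁ hP.left]
    have := hP.right
    rw [Cmd.length_compile] at this
    rw [ih₂ this, Cmd.size, add_assoc]
  | @cond_zero i c r hr =>
    have := hP.step r
    simp only [Function.iterate_one, this, Instr.exec, Cmd.size, hr, if_true]
    congr 1; ring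
  | @cond_pos i c r s r' hr _ ih =>
    have h₁ := hP.step r
    simp only [Instr.exec, hr, if_false] at h₁
    have h₂ : P.CodeAt (a + 1) (c.compile (a + 1)) :=
      Program.CodeAt.right (Q := [Instr.jumpZero i (a + 1 + c.size)]) hP
    rw [Function.iterate_add_apply, Function.iterate_one, h₁, ih h₂, Cmd.size]
    congr 1; ring
  | @loop_last i c r s r' _ hr ih =>
    have h₂ := hP.right
    rw [Cmd.length_compile] at h₂
    have h₃ := h₂.step r'
    simp only [Instr.exec, hr, if_false] at h₃
    rw [add_comm, Function.iterate_add_apply, Function.iterate_one, ih hP.left, h₃, Cmd.size,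
      add_assoc]
  | @loop_next i c r s r' s' r'' _ hr _ ih₁ ih₂ =>
    have h₂ := hP.right
    rw [Cmd.length_compile] at h₂
    have h₃ := h₂.step r'
    simp only [Instr.exec, hr, if_true] at h₃
    rw [add_comm, Function.iterate_add_apply, add_comm s, Function.iterate_add_apply,
      Function.iterate_one, ih₁ hP.left, h₃, ih₂ hP]

/-! ### Total correctness with time bounds -/

/-- Started with the registers `r`, the command `c` terminates within `T` steps in a state that
satisfies `Q`. -/
def Ensures (c : Cmd) (T : ℕ) (r : ℕ → ℕ) (Q : (ℕ → ℕ) → Prop) : Prop :=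
  ∃ t r', t ≤ T ∧ Exec c r t r' ∧ Q r'

namespace Ensures

variable {c d : Cmd} {T T₁ T₂ : ℕ} {r : ℕ → ℕ} {Q Q' : (ℕ → ℕ) → Prop} {i j k : ℕ}

theorem mono (h : Ensures c T₁ r Q') (hT : T₁ ≤ T) (hQ : ∀ r', Q' r' → Q r') :
    Ensures c T r Q := by
  obtain ⟨t, r', h₁, h₂, h₃⟩ := h
  exact ⟨t, r', h₁.trans hT, h₂, hQ _ h₃⟩

theorem const {x : ℕ} (h : Q (Function.update r i x)) : Ensures (.const i x) 1 r Q :=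
  ⟨1, _, le_rfl, .const .., h⟩

theorem add (h : ∀ x, x = r j + r k → Q (Function.update r i x)) : Ensures (.add i j k) 1 r Q :=
  ⟨1, _, le_rfl, .add .., h _ rfl⟩

theorem sub (h : ∀ x, x = r j - r k → Q (Function.update r i x)) : Ensures (.sub i j k) 1 r Q :=
  ⟨1, _, le_rfl, .sub .., h _ rfl⟩

theorem load (h : ∀ x, x = r (r j) → Q (Function.update r i x)) : Ensures (.load i j) 1 r Q :=
  ⟨1, _, le_rfl, .load .., h _ rfl⟩

theorem store (h : ∀ a x, a = r i → x = r j → Q (Function.update r a x)) :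
    Ensures (.store i j) 1 r Q :=
  ⟨1, _, le_rfl, .store .., h _ _ rfl rfl⟩

theorem seq (h : Ensures c T₁ r fun r' => Ensures d T₂ r' Q) (hT : T₁ + T₂ ≤ T) :
    Ensures (c ;; d) T r Q := by
  obtain ⟨t, r', h₁, h₂, t', r'', h₃, h₄, h₅⟩ := h
  exact ⟨t + t', r'', by omega, h₂.seq h₄, h₅⟩

theorem const_seq {x : ℕ} (h : Ensures d T (Function.update r i x) Q) :
    Ensures (.const i x ;; d) (T + 1) r Q := seq (const h) (by omega)

theorem add_seq (h : ∀ x, x = r j + r k → Ensures d T (Function.update r i x) Q) :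
    Ensures (.add i j k ;; d) (T + 1) r Q := seq (add h) (by omega)

theorem sub_seq (h : ∀ x, x = r j - r k → Ensures d T (Function.update r i x) Q) :
    Ensures (.sub i j k ;; d) (T + 1) r Q := seq (sub h) (by omega)

theorem load_seq (h : ∀ x, x = r (r j) → Ensures d T (Function.update r i x) Q) :
    Ensures (.load i j ;; d) (T + 1) r Q := seq (load h) (by omega)

theorem store_seq (h : ∀ a x, a = r i → x = r j → Ensures d T (Function.update r a x) Q) :
    Ensures (.store i j ;; d) (T + 1) r Q := seq (store h) (by omega)

theorem cond (h₀ : r i = 0 → Q r) (h₁ : r i ≠ 0 → Ensures c T r Q) :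
    Ensures (.cond i c) (T + 1) r Q := by
  by_cases h : r i = 0
  · exact ⟨1, r, by omega, .cond_zero h, h₀ h⟩
  · obtain ⟨t, r', h₂, h₃, h₄⟩ := h₁ h
    exact ⟨t + 1, r', by omega, .cond_pos h h₃, h₄⟩

/-- The rule for loops with a known number of rounds. -/
theorem loop {I : ℕ → (ℕ → ℕ) → Prop} {N : ℕ} (h₀ : I 0 r) (hN : 1 ≤ N)
    (h : ∀ k < N, ∀ r, I k r →
      Ensures c T r fun r' => I (k + 1) r' ∧ (r' i = 0 ↔ k + 1 < N)) :
    Ensures (.loop c i) (N * (T + 1)) r (I N) := by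
  suffices H : ∀ n k r, 1 ≤ n → k + n = N → I k r → Ensures (.loop c i) (n * (T + 1)) r (I N) from
    H N 0 r hN (by omega) h₀
  intro n
  induction n with
  | zero => intro _ _ h; omega
  | succ n ih =>
    intro k r _ hk hI
    obtain ⟨t, r', h₁, h₂, h₃, h₄⟩ := h k (by omega) r hI
    rcases Nat.eq_zero_or_pos n with rfl | hn
    · refine ⟨t + 1, r', by omega, .loop_last h₂ fun h => ?_, ?_⟩
      · have := h₄.1 h; omega
      · rwa [← hk]
    · obtain ⟨t', r'', h₅, h₆, h₇⟩ := ih (k + 1) r' hn (by omega) h₃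
      exact ⟨t + 1 + t', r'', by rw [Nat.succ_mul]; omega, .loop_next h₂ (h₄.2 (by omega)) h₆, h₇⟩

end Ensures

/-- Run `body` for the values `0, 1, …` of register `cnt` that are less than register `lim`,
and at least once. Register `3` has to contain `1`. -/
def Cmd.forLoop (cnt flag lim : ℕ) (body : Cmd) : Cmd :=
  .const cnt 0 ;; .loop (body ;; .add cnt cnt 3 ;; .add flag cnt 3 ;; .sub flag flag lim) flag

/-- After round `k` the flag is `k + 2 - N`, which vanishes exactly if another round is due.
Requiring the invariant for every `x` in `flag` spares the user from tracking this value. -/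
theorem Ensures.forLoop {cnt flag lim T N : ℕ} {body : Cmd} {r : ℕ → ℕ}
    {I : ℕ → (ℕ → ℕ) → Prop} (hN : 1 ≤ N)
    (hr : r 3 = 1) (hl : r lim = N)
    (h₀ : I 0 (Function.update r cnt 0))
    (h : ∀ k < N, ∀ r, r cnt = k → r 3 = 1 → r lim = N → I k r →
      Ensures body T r fun r' => r' cnt = k ∧ r' 3 = 1 ∧ r' lim = N ∧
        ∀ x, I (k + 1) (Function.update (Function.update r' cnt (k + 1)) flag x))
    (h3 : cnt ≠ 3 := by decide) (hc : cnt ≠ flag := by decide) (hf : flag ≠ 3 := by decide)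
    (hcl : cnt ≠ lim := by decide) (hfl : flag ≠ lim := by decide) :
    Ensures (.forLoop cnt flag lim body) (N * (T + 4) + 1) r
      fun r' => r' cnt = N ∧ r' 3 = 1 ∧ r' lim = N ∧ I N r' := by
  refine const_seq ?_
  refine Ensures.loop (T := T + 3)
    (I := fun k r => r cnt = k ∧ r 3 = 1 ∧ r lim = N ∧ I k r) ⟨?_, ?_, ?_, h₀⟩ hN ?_
  · simp
  · rw [Function.update_of_ne h3.symm, hr]
  · rw [Function.update_of_ne hcl.symm, hl]
  rintro k hk r ⟨h₁, h₂, h₃, h₄⟩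
  refine Ensures.seq (T₁ := T) (T₂ := 3) ?_ le_rfl
  refine (h k hk r h₁ h₂ h₃ h₄).mono le_rfl ?_
  rintro r' ⟨g₁, g₂, g₃, g₄⟩
  refine add_seq fun _ e₁ => add_seq fun _ e₂ => Ensures.sub fun _ e₃ => ?_
  subst e₁ e₂ e₃
  have g := g₄ (k + 1 + 1 - N)
  simp only [Function.update_self, Function.update_of_ne hc, Function.update_of_ne h3.symm,
    Function.update_of_ne hf.symm, Function.update_of_ne hcl.symm,
    Function.update_of_ne hfl.symm, g₁, g₂, g₃, Function.update_idem]
  exact ⟨⟨trivial, trivial, trivial, g⟩, by omega⟩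

/-- Register `d` becomes the product of the registers `a` and `b`; register `b` has to be positive.
The registers `28`, `29` and `30` are used for auxiliary values. -/
def Cmd.mul (d a b : ℕ) : Cmd :=
  .const 28 0 ;; .forLoop 29 30 b (.add 28 28 a) ;; .const 29 0 ;; .add d 28 29

/-- Multiplication is repeated addition, so the time is linear in the second factor. -/
theorem Ensures.mul {d a b : ℕ} {r : ℕ → ℕ} (hr : r 3 = 1) (hb : 1 ≤ r b)
    (ha' : a < 28) (hb' : b < 28) :
    Ensures (.mul d a b) (r b * 5 + 4) r fun r' => r' d = r a * r b ∧
      ∀ i, i ≠ d → i ≠ 28 → i ≠ 29 → i ≠ 30 → r' i = r i := by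
  refine const_seq ?_
  refine Ensures.seq (T₁ := r b * (1 + 4) + 1) (T₂ := 2) ?_ (by omega)
  refine (Ensures.forLoop (I := fun k s => s 28 = r a * k ∧
    ∀ i, i ≠ 28 → i ≠ 29 → i ≠ 30 → s i = r i) (N := r b) hb (by grind) (by grind) (by grind) ?_
    (by decide) (by decide) (by decide) (by omega) (by omega)).mono le_rfl ?_
  · intro k hk s h₁ h₂ h₃ h₄
    refine add fun x hx => ?_
    grind
  · rintro s ⟨h₁, h₂, h₃, h₄, h₅⟩
    refine const_seq (add fun x hx => ?_)
    grind

open Ensures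

/-! ### Testing the majorization inequalities -/

/-- For the threshold `θ` in register `4`, sum up `θ - y c` in register `9` and `y c` in
register `10`; the vector `y` of length `R 1` starts at the address `R 2`. -/
def Cmd.hingeSum : Cmd :=
  .const 9 0 ;; .const 10 0 ;;
  .forLoop 8 13 1 (.add 11 2 8 ;; .load 12 11 ;; .add 10 10 12 ;; .sub 12 4 12 ;; .add 9 9 12)

/-- Set register `7` to `1` or `0`, depending on whether the inequalities of `Hinge` hold. -/
def Cmd.hinge : Cmd :=
  .const 4 0 ;; .const 5 0 ;; .const 7 0 ;;
  .forLoop 6 14 1 (Cmd.hingeSum ;; .sub 9 9 5 ;; .add 7 7 9 ;; .add 4 4 0 ;; .add 5 5 4) ;;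
  .sub 5 5 4 ;; .sub 11 10 5 ;; .add 7 7 11 ;; .sub 11 5 10 ;; .add 7 7 11 ;; .sub 7 3 7

/-- The registers contain the numbers `n` and `m`, and a vector `y` of length `m` from the address
`Y` on. -/
structure Holds (n m Y : ℕ) (y : ℕ → ℕ) (r : ℕ → ℕ) : Prop where
  zero : r 0 = n
  one : r 1 = m
  two : r 2 = Y
  three : r 3 = 1
  le : 32 ≤ Y
  entry : ∀ c < m, r (Y + c) = y c

variable {n m Y C W : ℕ} {y : ℕ → ℕ}

theorem Holds.congr {r r' : ℕ → ℕ} (h : Holds n m Y y r)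
    (hr : ∀ i, i < 4 ∨ (Y ≤ i ∧ i < Y + m) → r' i = r i) : Holds n m Y y r' where
  zero := by rw [hr _ (by omega), h.zero]
  one := by rw [hr _ (by omega), h.one]
  two := by rw [hr _ (by omega), h.two]
  three := by rw [hr _ (by omega), h.three]
  le := h.le
  entry c hc := by rw [hr _ (by omega), h.entry c hc]

theorem ensures_hingeSum {r : ℕ → ℕ} (h : Holds n m Y y r) (hm : 1 ≤ m) :
    Ensures .hingeSum (m * 9 + 3) r fun r' => Holds n m Y y r' ∧
      (∀ i, i < 8 ∨ 13 < i → r' i = r i) ∧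
      r' 9 = ∑ c ∈ Finset.range m, (r 4 - y c) ∧ r' 10 = ∑ c ∈ Finset.range m, y c := by
  have hle := h.le
  have h3 := h.three
  have h1 := h.one
  refine const_seq (const_seq ?_)
  refine (forLoop (T := 5) (N := m) (I := fun k s => (∀ i, i < 8 ∨ 13 < i → s i = r i) ∧
    s 9 = ∑ c ∈ Finset.range k, (r 4 - y c) ∧ s 10 = ∑ c ∈ Finset.range k, y c) hm
    (by grind) (by grind) (by simp; grind) ?_).mono (by omega) ?_
  · intro k hk s g₁ g₂ g₃ ⟨g₄, g₅, g₆⟩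
    refine add_seq fun x₁ hx₁ => load_seq fun x₂ hx₂ => add_seq fun x₃ hx₃ =>
      sub_seq fun x₄ hx₄ => add fun x₅ hx₅ => ?_
    have e₁ : s (Y + k) = y k := by rw [g₄ _ (by omega), h.entry k hk]
    have e₂ : s 2 = Y := by rw [g₄ _ (by omega), h.two]
    simp only [Finset.sum_range_succ]
    grind
  · rintro s ⟨g₁, g₂, g₃, g₄, g₅, g₆⟩
    exact ⟨h.congr fun i hi => g₄ i (by omega), g₄, g₅, g₆⟩

/-- `Hinge` for a vector that is given by a function on the natural numbers. -/
theorem hinge_iff_range {y' : Fin m → ℕ} (hy : ∀ c : Fin m, y c = y' c) :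
    Hinge n y' ↔ (∀ k < m, ∑ c ∈ Finset.range m, (n * k - y c) ≤
      n * ∑ i ∈ Finset.range (k + 1), i) ∧
      ∑ c ∈ Finset.range m, y c = n * ∑ i ∈ Finset.range m, i := by
  have h₁ : ∀ k, ∑ c, (n * k - y' c) = ∑ c ∈ Finset.range m, (n * k - y c) := fun k => by
    rw [← Fin.sum_univ_eq_sum_range (fun c => n * k - y c)]
    simp [hy]
  have h₂ : ∑ c, y' c = ∑ c ∈ Finset.range m, y c := by
    rw [← Fin.sum_univ_eq_sum_range y]
    simp [hy]
  simp only [Hinge, h₁, h₂]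

theorem ensures_hinge {y' : Fin m → ℕ} (hy : ∀ c : Fin m, y c = y' c) {r : ℕ → ℕ}
    (h : Holds n m Y y r) (hm : 1 ≤ m) :
    Ensures .hinge (m * (m * 9 + 11) + 10) r fun r' => Holds n m Y y r' ∧
      (∀ i, i < 4 ∨ 14 < i → r' i = r i) ∧ (Hinge n y' → r' 7 = 1) ∧ (¬ Hinge n y' → r' 7 = 0) := by
  have hle := h.le
  have h3 := h.three
  have h1 := h.one
  rw [hinge_iff_range hy]
  refine const_seq (const_seq (const_seq ?_))
  refine Ensures.seq (T₁ := m * ((m * 9 + 7) + 4) + 1) (T₂ := 6) ?_ (by ring_nf; omega)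
  refine (forLoop (T := m * 9 + 7) (N := m) (I := fun k s => (∀ i, i < 4 ∨ 14 < i → s i = r i) ∧
    s 4 = n * k ∧ s 5 = n * ∑ i ∈ Finset.range (k + 1), i ∧
    (s 7 = 0 ↔ ∀ k' < k, ∑ c ∈ Finset.range m, (n * k' - y c) ≤
      n * ∑ i ∈ Finset.range (k' + 1), i) ∧
    (1 ≤ k → s 10 = ∑ c ∈ Finset.range m, y c)) hm
    (by grind) (by grind) (by simp; grind) ?_).mono (by omega) ?_
  · intro k hk s g₁ g₂ g₃ ⟨g₄, g₅, g₆, g₇, g₈⟩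
    refine Ensures.seq (T₁ := m * 9 + 3) (T₂ := 4) ?_ (by omega)
    refine (ensures_hingeSum (h.congr fun i hi => g₄ i (by omega)) hm).mono le_rfl ?_
    rintro s' ⟨e₁, e₂, e₃, e₄⟩
    refine sub_seq fun x₁ hx₁ => add_seq fun x₂ hx₂ => add_seq fun x₃ hx₃ => add fun x₄ hx₄ => ?_
    have e₅ := e₁.zero
    have e₆ := e₂ 4 (by omega)
    have e₇ := e₂ 5 (by omega)
    have e₈ := e₂ 6 (by omega)
    have e₉ := e₂ 7 (by omega)
    have e₁₀ := e₁.one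
    have e₁₁ := e₁.three
    have hfr : ∀ i, i < 4 ∨ 14 < i → s' i = r i := fun i hi => by
      rw [e₂ i (by omega), g₄ i hi]
    rw [g₅] at e₃
    have hsum : n * ∑ i ∈ Finset.range (k + 1 + 1), i =
        n * ∑ i ∈ Finset.range (k + 1), i + n * (k + 1) := by
      rw [Finset.sum_range_succ _ (k + 1), mul_add]
    have hsucc : n * (k + 1) = n * k + n := by ring
    have hiff : (s' 7 + (s' 9 - s' 5) = 0 ↔ ∀ k' < k + 1,
        ∑ c ∈ Finset.range m, (n * k' - y c) ≤ n * ∑ i ∈ Finset.range (k' + 1), i) := by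
      rw [Nat.forall_lt_succ_right, ← g₇, e₉, e₃, e₇, g₆]
      omega
    refine ⟨by grind, by grind, by grind, fun x => ⟨by grind, by grind, ?_, ?_, by grind⟩⟩
    · rw [hsum, hsucc]
      grind
    · rw [← hiff]
      grind
  · rintro s ⟨g₁, g₂, g₃, g₄, g₅, g₆, g₇, g₈⟩
    refine sub_seq fun x₁ hx₁ => sub_seq fun x₂ hx₂ => add_seq fun x₃ hx₃ =>
      sub_seq fun x₄ hx₄ => add_seq fun x₅ hx₅ => sub fun x₆ hx₆ => ?_
    -- After the loop, register `5` contains one term too many, `n * m`, which is just the value of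
    -- register `4`.
    rw [Finset.sum_range_succ, mul_add] at g₆
    have g₉ := g₈ hm
    rw [← g₇]
    set a := n * ∑ i ∈ Finset.range m, i
    set b := ∑ c ∈ Finset.range m, y c
    refine ⟨h.congr (by grind), by grind, by grind, by grind⟩

/-! ### The dynamic programming table -/

/-- The parameters of the table: the base of the codes, the number of codes, and the sizes of a
block, of a layer, of `n` layers, and of the region of a row. -/
structure TableParams (n m C W : ℕ) (r : ℕ → ℕ) : Prop where
  base : r 4 = n + 1
  codes : r 5 = (n + 1) ^ m
  block : r 9 = C
  layer : r 10 = C * W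
  layers : r 11 = n * (C * W)
  region : r 12 = (n + 1) * (C * W)

theorem TableParams.congr {n m C W : ℕ} {r r' : ℕ → ℕ} (h : TableParams n m C W r)
    (hr : ∀ i, 3 < i ∧ i < 13 ∧ i ≠ 7 → r' i = r i) : TableParams n m C W r' where
  base := by rw [hr _ (by omega), h.base]
  codes := by rw [hr _ (by omega), h.codes]
  block := by rw [hr _ (by omega), h.block]
  layer := by rw [hr _ (by omega), h.layer]
  layers := by rw [hr _ (by omega), h.layers]
  region := by rw [hr _ (by omega), h.region]

/-- Add register `17` to the table entry with the address `R 19 + R 20`, and prepare the registers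
`19` and `20` for the next push. -/
def Cmd.push : Cmd :=
  .add 21 19 20 ;; .load 22 21 ;; .add 22 22 17 ;; .store 21 22 ;; .add 19 19 9 ;; .mul 20 20 4

/-- Add the table entry at the address in register `15` to the entries that are `D k` places
further on, and increase the address. -/
def Cmd.visit : Cmd :=
  .load 17 15 ;; .const 20 1 ;; .add 19 15 10 ;;
  .forLoop 18 23 1 .push ;;
  .add 15 15 3

/-- Visit the first `n` layers of the region that starts at the address in register `13`. -/
def Cmd.visitLayers : Cmd :=
  .const 15 0 ;; .add 15 15 13 ;; .forLoop 16 24 11 .visit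

/-- Copy a block of the table from the address in register `22` to the address in
register `21`. -/
def Cmd.copyBlock : Cmd :=
  .forLoop 16 24 9 (.load 17 22 ;; .store 21 17 ;; .add 21 21 3 ;; .add 22 22 3)

/-- Go on to the next region: select the block that belongs to the correct score of the row. -/
def Cmd.nextRegion : Cmd :=
  .add 21 2 14 ;; .load 22 21 ;; .mul 22 22 9 ;; .add 22 22 13 ;; .add 22 22 11 ;;
  .add 13 13 12 ;; .const 21 0 ;; .add 21 21 13 ;; .copyBlock

theorem ensures_push {r : ℕ → ℕ} {b u p : ℕ} (h3 : r 3 = 1) (h4 : r 4 = b) (hb : 1 ≤ b)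
    (h19 : r 19 = u) (h20 : r 20 = p) (hup : 32 ≤ u + p) :
    Ensures .push (b * 5 + 9) r fun r' =>
      (∀ i, i < 19 ∨ (22 < i ∧ i < 28) → r' i = r i) ∧ r' 19 = u + r 9 ∧ r' 20 = p * b ∧
      r' (u + p) = r (u + p) + r 17 ∧ ∀ a, 32 ≤ a → a ≠ u + p → r' a = r a := by
  refine add_seq fun x₁ hx₁ => load_seq fun x₂ hx₂ => add_seq fun x₃ hx₃ =>
    store_seq fun a x₄ ha hx₄ => add_seq fun x₅ hx₅ => ?_
  have e₁ : x₁ = u + p := by rw [hx₁, h19, h20]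
  have e₂ : x₂ = r (u + p) := by
    rw [hx₂, Function.update_self, e₁, Function.update_of_ne (by omega)]
  have e₃ : x₃ = r (u + p) + r 17 := by
    rw [hx₃, ← e₂]
    simp
  have ea : a = u + p := by
    rw [ha, ← e₁]
    simp
  have e₄ : x₄ = r (u + p) + r 17 := by
    rw [hx₄, ← e₃]
    simp
  have hlow : ∀ i, i < 19 ∨ (19 < i ∧ i < 21) ∨ (22 < i ∧ i < 32) → ∀ v, Function.update
      (Function.update (Function.update (Function.update (Function.update r 21 x₁) 22 x₂) 22 x₃)
        a x₄) 19 v i = r i := by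
    intro i hi v
    rw [Function.update_of_ne (by omega), Function.update_of_ne (by omega),
      Function.update_of_ne (by omega), Function.update_of_ne (by omega),
      Function.update_of_ne (by omega)]
  have e₅ : x₅ = u + r 9 := by
    rw [hx₅]
    congr 1
    · rw [Function.update_of_ne (by omega), Function.update_of_ne (by omega),
        Function.update_of_ne (by omega), Function.update_of_ne (by omega), h19]
    · rw [Function.update_of_ne (by omega), Function.update_of_ne (by omega),
        Function.update_of_ne (by omega), Function.update_of_ne (by omega)]
  clear hx₁ hx₂ hx₃ ha hx₄ hx₅
  have hmem : ∀ i, 32 ≤ i → Function.update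
      (Function.update (Function.update (Function.update (Function.update r 21 x₁) 22 x₂) 22 x₃)
        a x₄) 19 x₅ i = Function.update r a x₄ i := by
    intro i hi
    rw [Function.update_of_ne (by omega)]
    by_cases h : i = a
    · rw [h, Function.update_self, Function.update_self]
    · rw [Function.update_of_ne h, Function.update_of_ne h, Function.update_of_ne (by omega),
        Function.update_of_ne (by omega), Function.update_of_ne (by omega)]
  have f₄ := hlow 4 (by omega) x₅
  refine (Ensures.mul (by rw [hlow _ (by omega), h3]) (by rw [f₄]; omega) (by omega)
    (by omega)).mono (by rw [f₄]; omega) ?_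
  rintro s ⟨g₁, g₂⟩
  refine ⟨fun i hi => ?_, ?_, ?_, ?_, fun i hi hia => ?_⟩
  · rw [g₂ i (by omega) (by omega) (by omega) (by omega), hlow i (by omega)]
  · rw [g₂ _ (by omega) (by omega) (by omega) (by omega), Function.update_self, e₅]
  · rw [g₁, f₄, h4, hlow _ (by omega), h20]
  · rw [g₂ _ (by omega) (by omega) (by omega) (by omega), hmem _ (by omega), ← ea,
      Function.update_self, e₄, ea]
  · rw [g₂ _ (by omega) (by omega) (by omega) (by omega), hmem _ hi,
      Function.update_of_ne (by omega)]

/-- Table entries are natural numbers that are only ever added to, so pushing takes no case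
distinction; only whether an entry is zero matters. All targets lie beyond `P`, so the pushed value
stays fixed. -/
theorem ensures_visit {r : ℕ → ℕ} {P : ℕ} (h1 : r 1 = m) (h3 : r 3 = 1)
    (h : TableParams n m C W r) (h15 : r 15 = P) (hP : 32 ≤ P) (hm : 1 ≤ m) :
    Ensures .visit (m * (5 * n + 18) + 5) r fun r' =>
      (∀ i, i < 15 ∨ i = 16 ∨ (23 < i ∧ i < 28) → r' i = r i) ∧ r' 15 = P + 1 ∧
      (∀ a, 32 ≤ a → a ≤ P → r' a = r a) ∧
      (∀ a, 32 ≤ a → (r' a ≠ 0 ↔ r a ≠ 0 ∨ (r P ≠ 0 ∧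
        ∃ k < m, a = P + (C * W + k * C + (n + 1) ^ k)))) := by
  have h4 := h.base
  have h9 := h.block
  have h10 := h.layer
  refine load_seq fun x₁ hx₁ => const_seq (add_seq fun x₂ hx₂ => ?_)
  refine Ensures.seq (T₁ := m * ((5 * n + 14) + 4) + 1) (T₂ := 1) ?_ (by ring_nf; omega)
  refine (forLoop (T := 5 * n + 14) (N := m) (I := fun k s =>
    (∀ i, i < 17 ∨ (23 < i ∧ i < 28) → s i = r i) ∧ s 17 = r P ∧ s 19 = P + C * W + k * C ∧
    s 20 = (n + 1) ^ k ∧ (∀ a, 32 ≤ a → a ≤ P → s a = r a) ∧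
    (∀ a, 32 ≤ a → (s a ≠ 0 ↔ r a ≠ 0 ∨ (r P ≠ 0 ∧
        ∃ j < k, a = P + (C * W + j * C + (n + 1) ^ j))))) hm
    (by grind) (by grind) ⟨by grind, by grind, by grind, by simp, by grind, by simp; grind⟩
    ?_).mono (by omega) ?_
  · intro k hk s g₁ g₂ g₃ ⟨g₄, g₅, g₆, g₇, g₈, g₉⟩
    have hpow : 1 ≤ (n + 1) ^ k := Nat.one_le_pow _ _ (by omega)
    refine (ensures_push g₂ (by rw [g₄ _ (by omega), h4]) (by omega) g₆ g₇ (by omega)).mono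
      (by omega) ?_
    rintro s' ⟨k₁, k₂, k₃, k₄, k₅⟩
    refine ⟨by rw [k₁ _ (by omega), g₁], by rw [k₁ _ (by omega), g₂], by rw [k₁ _ (by omega), g₃],
      fun x => ?_⟩
    have hup : ∀ i, i ≠ 18 → i ≠ 23 →
        Function.update (Function.update s' 18 (k + 1)) 23 x i = s' i := by
      intro i _ _
      grind
    refine ⟨fun i hi => ?_, ?_, ?_, ?_, fun i hi hi' => ?_, fun i hi => ?_⟩
    · rw [hup i (by omega) (by omega), k₁ i (by omega), g₄ i hi]
    · rw [hup _ (by omega) (by omega), k₁ _ (by omega), g₅]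
    · rw [hup _ (by omega) (by omega), k₂, g₄ _ (by omega), h9]
      ring
    · rw [hup _ (by omega) (by omega), k₃, pow_succ]
    · rw [hup i (by omega) (by omega), k₅ i hi (by omega), g₈ i hi hi']
    · rw [hup i (by omega) (by omega)]
      have e : (∃ j < k + 1, i = P + (C * W + j * C + (n + 1) ^ j)) ↔
          ((∃ j < k, i = P + (C * W + j * C + (n + 1) ^ j)) ∨
            i = P + C * W + k * C + (n + 1) ^ k) := by
        simp only [add_assoc]
        constructor
        · rintro ⟨j, hj, hj'⟩
          rcases Nat.lt_succ_iff_lt_or_eq.1 hj with h | rfl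
          · exact Or.inl ⟨j, h, hj'⟩
          · exact Or.inr hj'
        · rintro (⟨j, hj, hj'⟩ | h)
          · exact ⟨j, by omega, hj'⟩
          · exact ⟨k, by omega, h⟩
      rw [e]
      by_cases hi' : i = P + C * W + k * C + (n + 1) ^ k
      · have h₀ : s i + r P ≠ 0 ↔ s i ≠ 0 ∨ r P ≠ 0 := by omega
        have k₆ : s' i = s i + r P := by rw [hi', k₄, g₅]
        rw [k₆, h₀, g₉ i hi]
        tauto
      · rw [k₅ i hi hi', g₉ i hi, or_iff_left hi']
  · rintro s ⟨g₁, g₂, g₃, g₄, g₅, g₆, g₇, g₈, g₉⟩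
    refine add fun x hx => ?_
    have := g₄ 15 (by omega)
    refine ⟨by grind, by grind, by grind, fun a ha => ?_⟩
    rw [Function.update_of_ne (by omega)]
    exact g₉ a ha

/-- The loop invariant is that the nonzero cells after `N` visits form `keysBelow A D N`. -/
theorem ensures_visitLayers {r : ℕ → ℕ} {B : ℕ} (h1 : r 1 = m) (h3 : r 3 = 1)
    (h : TableParams n m C W r) (h13 : r 13 = B) (hB : 32 ≤ B) (hm : 1 ≤ m) (hn : 1 ≤ n)
    (hL : 1 ≤ C * W) {A : Set ℕ} (hA : ∀ M, r (B + M) ≠ 0 ↔ M ∈ A) :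
    Ensures .visitLayers (n * (C * W) * (m * (5 * n + 18) + 9) + 3) r fun r' =>
      (∀ i, i < 15 ∨ (24 < i ∧ i < 28) ∨ (32 ≤ i ∧ i < B) → r' i = r i) ∧
      ∀ M, r' (B + M) ≠ 0 ↔ M ∈ keysBelow A
        (fun k : Fin m => C * W + k * C + (n + 1) ^ (k : ℕ)) (n * (C * W)) := by
  set D := fun k : Fin m => C * W + k * C + (n + 1) ^ (k : ℕ) with hD
  have hD1 : ∀ k, 1 ≤ D k := fun k => by simp only [hD]; omega
  have h11 := h.layers
  refine const_seq (add_seq fun x₁ hx₁ => ?_)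
  have e₁ : x₁ = B := by grind
  refine (forLoop (T := m * (5 * n + 18) + 5) (N := n * (C * W)) (I := fun N s =>
    (∀ i, i < 15 ∨ (24 < i ∧ i < 28) ∨ (32 ≤ i ∧ i < B) → s i = r i) ∧ s 15 = B + N ∧
    ∀ M, s (B + M) ≠ 0 ↔ M ∈ keysBelow A D N) (Nat.mul_pos hn hL)
    (by grind) (by grind) ⟨by grind, by grind, fun M => ?_⟩ ?_).mono (by ring_nf; omega) ?_
  · rw [Function.update_of_ne (by omega), Function.update_of_ne (by omega),
      Function.update_of_ne (by omega), hA]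
    simp [keysBelow]
  · intro N hN s g₁ g₂ g₃ ⟨g₄, g₅, g₆⟩
    refine (ensures_visit (by rw [g₄ _ (by omega), h1]) g₂ (h.congr fun i hi => g₄ i (by omega)) g₅
      (by omega) hm).mono le_rfl ?_
    rintro s' ⟨k₁, k₂, k₃, k₄⟩
    refine ⟨by rw [k₁ _ (by omega), g₁], by rw [k₁ _ (by omega), g₂], by rw [k₁ _ (by omega), g₃],
      fun x => ?_⟩
    have hup : ∀ i, i ≠ 16 → i ≠ 24 →
        Function.update (Function.update s' 16 (N + 1)) 24 x i = s' i := by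
      intro i _ _
      grind
    refine ⟨fun i hi => ?_, ?_, fun M => ?_⟩
    · rw [hup i (by omega) (by omega), ← g₄ i hi]
      rcases hi with hi | hi | hi
      · exact k₁ i (by omega)
      · exact k₁ i (by omega)
      · exact k₃ i (by omega) (by omega)
    · rw [hup _ (by omega) (by omega), k₂]
      ring
    · rw [hup _ (by omega) (by omega), k₄ _ (by omega), mem_keysBelow_succ, g₆ M, g₆ N,
        mem_keysBelow_self hD1]
      refine or_congr Iff.rfl (and_congr Iff.rfl ⟨?_, ?_⟩)
      · rintro ⟨k, hk, hM⟩
        exact ⟨⟨k, hk⟩, by simp only [hD]; omega⟩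
      · rintro ⟨k, hM⟩
        exact ⟨k, k.2, by simp only [hD] at hM; omega⟩
  · rintro s ⟨-, -, -, g₄, g₅, g₆⟩
    exact ⟨g₄, g₆⟩

theorem ensures_copyBlock {r : ℕ → ℕ} {S B : ℕ} (h3 : r 3 = 1) (h9 : r 9 = C) (h21 : r 21 = B)
    (h22 : r 22 = S) (hS : 32 ≤ S) (hSB : S + C ≤ B) (hC : 1 ≤ C) :
    Ensures .copyBlock (C * 8 + 1) r fun r' =>
      (∀ i, i < 16 ∨ (24 < i ∧ i < B) ∨ B + C ≤ i → r' i = r i) ∧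
      ∀ q < C, r' (B + q) = r (S + q) := by
  refine (forLoop (T := 4) (N := C) (I := fun k s =>
    (∀ i, i < 16 ∨ (24 < i ∧ i < B) ∨ B + k ≤ i → s i = r i) ∧ s 21 = B + k ∧ s 22 = S + k ∧
    ∀ q < k, s (B + q) = r (S + q)) hC h3 h9
    ⟨by grind, by grind, by grind, by simp⟩ ?_).mono (by omega) ?_
  · intro k hk s g₁ g₂ g₃ ⟨g₄, g₅, g₆, g₇⟩
    refine load_seq fun x₁ hx₁ => store_seq fun a x₂ ha hx₂ => add_seq fun x₃ hx₃ =>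
      add fun x₄ hx₄ => ?_
    have e₁ : x₁ = r (S + k) := by rw [hx₁, g₆, g₄ _ (by omega)]
    have ea : a = B + k := by grind
    have e₂ : x₂ = x₁ := by grind
    have e₃ : x₃ = B + (k + 1) := by grind
    have e₄ : x₄ = S + (k + 1) := by grind
    clear hx₁ hx₂ ha hx₃ hx₄
    refine ⟨by grind, by grind, by grind, fun x => ?_⟩
    have hup : ∀ i, i < 16 ∨ 24 < i → Function.update (Function.update (Function.update
        (Function.update (Function.update (Function.update s 17 x₁) a x₂) 21 x₃) 22 x₄) 16 (k + 1))
          24 x i = Function.update s a x₂ i := by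
      intro i hi
      rw [Function.update_of_ne (by omega), Function.update_of_ne (by omega),
        Function.update_of_ne (by omega), Function.update_of_ne (by omega)]
      by_cases h : i = a
      · rw [h, Function.update_self, Function.update_self]
      · rw [Function.update_of_ne h, Function.update_of_ne h, Function.update_of_ne (by omega)]
    refine ⟨fun i hi => ?_, by simp [e₃], by simp [e₄], fun q hq => ?_⟩
    · rw [hup i (by omega), Function.update_of_ne (by omega), g₄ i (by omega)]
    · rw [hup _ (by omega)]
      rcases Nat.lt_succ_iff_lt_or_eq.1 hq with h | rfl
      · rw [Function.update_of_ne (by omega), g₇ q h]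
      · rw [← ea, Function.update_self, e₂, e₁]
  · rintro s ⟨-, -, -, g₄, g₅, g₆, g₇⟩
    exact ⟨g₄, g₇⟩

theorem ensures_nextRegion {r : ℕ → ℕ} {B c : ℕ} (h : Holds n m Y y r)
    (hp : TableParams n m C W r) (h13 : r 13 = B) (h14 : r 14 = c) (hc : c < m) (hB : 32 ≤ B)
    (hC : 1 ≤ C) (hyc : y c < W) :
    Ensures .nextRegion (C * 13 + 12) r fun r' =>
      (∀ i, i < 13 ∨ i = 14 ∨ (24 < i ∧ i < 28) ∨ (32 ≤ i ∧ i < B + (n + 1) * (C * W)) ∨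
        B + (n + 1) * (C * W) + C ≤ i → r' i = r i) ∧
      r' 13 = B + (n + 1) * (C * W) ∧
      ∀ q < C, r' (B + (n + 1) * (C * W) + q) = r (B + (n * (C * W) + (y c * C + q))) := by
  have h2 := h.two
  have h3 := h.three
  have hle := h.le
  have h9 := hp.block
  have h11 := hp.layers
  have h12 := hp.region
  have hLW : y c * C + C ≤ C * W := by
    rw [← Nat.succ_mul, mul_comm]
    exact Nat.mul_le_mul_left _ hyc
  have hsucc : (n + 1) * (C * W) = n * (C * W) + C * W := Nat.succ_mul _ _
  refine add_seq fun x₁ hx₁ => load_seq fun x₂ hx₂ => ?_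
  have e₁ : x₁ = Y + c := by rw [hx₁, h2, h14]
  have e₂ : x₂ = y c := by
    rw [hx₂, Function.update_self, e₁, Function.update_of_ne (by omega), h.entry c hc]
  clear hx₁ hx₂
  refine Ensures.seq (T₁ := C * 5 + 4) (T₂ := C * 8 + 6) ?_ (by omega)
  refine (Ensures.mul (by grind) (by grind) (by omega) (by omega)).mono (by grind) ?_
  rintro s ⟨g₁, g₂⟩
  have g₃ : s 22 = y c * C := by
    rw [g₁, Function.update_self, e₂, Function.update_of_ne (by omega),
      Function.update_of_ne (by omega), h9]
  have g₄ : ∀ i, i ≠ 21 → i ≠ 22 → i < 28 ∨ 31 < i → s i = r i := fun i _ _ _ => by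
    rw [g₂ i (by omega) (by omega) (by omega) (by omega), Function.update_of_ne (by omega),
      Function.update_of_ne (by omega)]
  clear g₁ g₂
  refine add_seq fun x₃ hx₃ => add_seq fun x₄ hx₄ => add_seq fun x₅ hx₅ => const_seq
    (add_seq fun x₆ hx₆ => ?_)
  have s13 : s 13 = B := by rw [g₄ _ (by omega) (by omega) (by omega), h13]
  have s11 : s 11 = n * (C * W) := by rw [g₄ _ (by omega) (by omega) (by omega), h11]
  have s12 : s 12 = (n + 1) * (C * W) := by rw [g₄ _ (by omega) (by omega) (by omega), h12]
  have e₃ : x₃ = y c * C + B := by rw [hx₃, g₃, s13]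
  have e₄ : x₄ = y c * C + B + n * (C * W) := by
    rw [hx₄, ← e₃, ← s11]
    simp
  have e₅ : x₅ = B + (n + 1) * (C * W) := by
    rw [hx₅, ← s12, ← s13]
    simp
  have e₆ : x₆ = B + (n + 1) * (C * W) := by
    rw [hx₆, ← e₅]
    simp
  clear hx₃ hx₄ hx₅ hx₆
  set s' := Function.update (Function.update (Function.update (Function.update
    (Function.update s 22 x₃) 22 x₄) 13 x₅) 21 0) 21 x₆ with hs'
  have hup : ∀ i, i ≠ 13 → i ≠ 21 → i ≠ 22 → s' i = s i := fun i _ _ _ => by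
    rw [hs', Function.update_of_ne (by omega), Function.update_of_ne (by omega),
      Function.update_of_ne (by omega), Function.update_of_ne (by omega),
      Function.update_of_ne (by omega)]
  have s21 : s' 21 = x₆ := Function.update_self ..
  have s22 : s' 22 = x₄ := by simp [hs']
  have s13 : s' 13 = x₅ := by simp [hs']
  clear_value s'
  refine (ensures_copyBlock (by rw [hup _ (by omega) (by omega) (by omega),
      g₄ _ (by omega) (by omega) (by omega), h3]) (by rw [hup _ (by omega) (by omega) (by omega),
      g₄ _ (by omega) (by omega) (by omega), h9]) (s21.trans e₆) s22 (by omega) (by omega)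
      hC).mono le_rfl ?_
  rintro s'' ⟨k₁, k₂⟩
  refine ⟨fun i hi => ?_, ?_, fun q hq => ?_⟩
  · rw [k₁ i (by omega), hup i (by omega) (by omega) (by omega),
      g₄ i (by omega) (by omega) (by omega)]
  · rw [k₁ _ (by omega), s13, e₅]
  · rw [k₂ q hq, hup _ (by omega) (by omega) (by omega), g₄ _ (by omega) (by omega) (by omega), e₄]
    congr 1
    ring

/-- Process all rows. -/
def Cmd.rows : Cmd := .forLoop 14 25 1 (.visitLayers ;; .nextRegion)

/-- Invariant: from the start of region `c` on, the nonzero cells are at the codes of the first `c`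
rows. Every row has a fresh region, so no cell has to be cleared. `hC` bounds the codes of all
prefixes, including the row being added. -/
theorem ensures_rows {r : ℕ → ℕ} (h : Holds n m Y y r) (hp : TableParams n m C W r)
    (h13 : r 13 = Y + m) (hm : 1 ≤ m) (hn : 1 ≤ n) (hC : m * n * (n + 1) ^ m < C)
    (hW : n * m < W) (hy : ∀ c < m, y c < W) (hT : ∀ M, r (Y + m + M) ≠ 0 ↔ M = 0) :
    Ensures .rows (m * (n * (C * W) * (m * (5 * n + 18) + 9) + C * 13 + 19) + 1) r fun r' =>
      r' 3 = 1 ∧ r' 5 = (n + 1) ^ m ∧ 32 ≤ r' 13 ∧ (∀ i < 3, r' i = r i) ∧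
      ∀ M, r' (r' 13 + M) ≠ 0 ↔ M ∈ prefixCodes m (n + 1) n y m := by
  have hle := h.le
  have hCW : 1 ≤ C * W := Nat.mul_pos (by omega) (by omega)
  refine (forLoop (T := n * (C * W) * (m * (5 * n + 18) + 9) + 3 + (C * 13 + 12)) (N := m)
    (I := fun c s => Holds n m Y y s ∧ TableParams n m C W s ∧
      s 13 = Y + m + c * ((n + 1) * (C * W)) ∧ (∀ i < 3, s i = r i) ∧
      ∀ M, s (Y + m + c * ((n + 1) * (C * W)) + M) ≠ 0 ↔ M ∈ prefixCodes m (n + 1) n y c) hm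
    h.three h.one ?_ ?_).mono (by ring_nf; omega) ?_
  · refine ⟨h.congr fun i hi => Function.update_of_ne (by omega) _ _,
      hp.congr fun i hi => Function.update_of_ne (by omega) _ _, ?_, fun i hi =>
      Function.update_of_ne (by omega) _ _, fun M => ?_⟩
    · rw [Function.update_of_ne (by omega), h13]
      ring
    · rw [zero_mul, add_zero, Function.update_of_ne (by omega), hT]
      rfl
  · rintro c hc s g₁ g₂ g₃ ⟨k₁, k₂, k₃, k₄, k₅⟩
    have hA : ∀ q ∈ prefixCodes m (n + 1) n y c, q ≤ c * n * (n + 1) ^ m := fun q hq =>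
      le_of_mem_prefixCodes (by omega) hq
    have hC' : c * n * (n + 1) ^ m + n * (n + 1) ^ m < C := by
      refine lt_of_le_of_lt ?_ hC
      rw [← add_mul, ← Nat.succ_mul]
      exact Nat.mul_le_mul_right _ (Nat.mul_le_mul_right _ hc)
    have hB' : Y + m + (c + 1) * ((n + 1) * (C * W)) =
        Y + m + c * ((n + 1) * (C * W)) + (n + 1) * (C * W) := by ring
    set B := Y + m + c * ((n + 1) * (C * W)) with hB
    have hBY : Y + m ≤ B := by omega
    refine Ensures.seq ?_ le_rfl
    refine (ensures_visitLayers g₃ g₂ k₂ k₃ (by omega) hm hn hCW k₅).mono le_rfl ?_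
    rintro s₁ ⟨l₁, l₂⟩
    refine (ensures_nextRegion (k₁.congr fun i hi => l₁ i (by omega))
      (k₂.congr fun i hi => l₁ i (by omega)) ((l₁ _ (by omega)).trans k₃)
      ((l₁ _ (by omega)).trans g₁) hc (by omega) (by omega) (hy c hc)).mono le_rfl ?_
    rintro s₂ ⟨p₁, p₂, p₃⟩
    refine ⟨by rw [p₁ _ (by omega), l₁ _ (by omega), g₁],
      by rw [p₁ _ (by omega), l₁ _ (by omega), g₂], by rw [p₁ _ (by omega), l₁ _ (by omega), g₃],
      fun x => ?_⟩
    have hup : ∀ i, i ≠ 14 → i ≠ 25 →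
        Function.update (Function.update s₂ 14 (c + 1)) 25 x i = s₂ i := fun i _ _ => by
      rw [Function.update_of_ne (by omega), Function.update_of_ne (by omega)]
    have hreg : ∀ i, i < 13 ∨ (32 ≤ i ∧ i < B) →
        Function.update (Function.update s₂ 14 (c + 1)) 25 x i = s i := fun i hi => by
      rw [hup i (by omega) (by omega), p₁ i (by omega), l₁ i (by omega)]
    rw [hB']
    refine ⟨k₁.congr fun i hi => hreg i (by omega), k₂.congr fun i hi => hreg i (by omega), ?_,
      fun i hi => (hreg i (by omega)).trans (k₄ i hi), fun M => ?_⟩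
    · rw [hup _ (by omega) (by omega), p₂]
    · rw [hup _ (by omega) (by omega)]
      -- Offsets below `C` have just been copied. Beyond them the memory is still zero, as no key
      -- reached past the previous region, and no code is that large.
      rcases lt_or_ge M C with hM | hM
      · rw [p₃ M hM, l₂, mem_keysBelow_iff (by omega) hA hC' hW hn (hy c hc) hM]
        rfl
      · rw [p₁ _ (by omega), add_assoc, l₂]
        constructor
        · intro h
          have := lt_of_mem_keysBelow (by omega) hA hC' hW h
          omega
        · intro h
          have := le_of_mem_prefixCodes (by omega) h
          have := Nat.mul_le_mul_right ((n + 1) ^ m)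
            (Nat.mul_le_mul_right n (show c + 1 ≤ m from hc))
          omega
  · rintro s ⟨-, g₂, -, k₁, k₂, k₃, k₄, k₅⟩
    refine ⟨g₂, k₂.codes, by omega, k₄, fun M => ?_⟩
    rw [k₃]
    exact k₅ M

/-- Compute the parameters of the table, which starts after the vector `y`, and its first entry. -/
def Cmd.tableInit : Cmd :=
  .add 4 0 3 ;; .const 5 1 ;; .forLoop 6 8 1 (.mul 5 5 4) ;; .mul 6 0 1 ;; .mul 8 6 1 ;;
  .add 8 8 3 ;; .add 6 6 3 ;; .mul 9 5 6 ;; .mul 10 9 8 ;; .mul 11 10 0 ;; .add 12 11 10 ;;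
  .add 13 2 1 ;; .store 13 3

theorem ensures_tableInit {r : ℕ → ℕ} (h : Holds n m Y y r) (hm : 1 ≤ m) (hn : 1 ≤ n)
    (hT : ∀ a, Y + m ≤ a → r a = 0) :
    Ensures .tableInit (m * (n * 5 + 13) + m * 5 + m * 5 + (n * m + 1) * 5 + (n * m * m + 1) * 5 +
        n * 5 + 29) r fun r' =>
      Holds n m Y y r' ∧ TableParams n m ((n + 1) ^ m * (n * m + 1)) (n * m * m + 1) r' ∧
      r' 13 = Y + m ∧ ∀ M, r' (Y + m + M) ≠ 0 ↔ M = 0 := by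
  have h0 := h.zero
  have h1 := h.one
  have h2 := h.two
  have h3 := h.three
  have hle := h.le
  have hnm : 1 ≤ n * m := Nat.mul_pos hn hm
  refine (add_seq fun x₁ hx₁ => const_seq (Ensures.seq (T₁ := m * (n * 5 + 13) + 1)
    (T₂ := m * 5 + m * 5 + (n * m + 1) * 5 + (n * m * m + 1) * 5 + n * 5 + 26) ?_ le_rfl)).mono
    (by omega) fun _ => id
  refine (forLoop (T := n * 5 + 9) (N := m) (I := fun k s =>
    (∀ i, i < 4 ∨ 31 < i → s i = r i) ∧ s 4 = n + 1 ∧ s 5 = (n + 1) ^ k) hm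
    (by grind) (by grind) ⟨by grind, by grind, by simp⟩ ?_).mono le_rfl ?_
  · rintro k hk s g₁ g₂ g₃ ⟨g₄, g₅, g₆⟩
    refine (Ensures.mul g₂ (by omega) (by omega) (by omega)).mono (by omega) ?_
    rintro s' ⟨k₁, k₂⟩
    rw [g₅, g₆, ← pow_succ] at k₁
    exact ⟨by grind, by grind, by grind, fun x => ⟨by grind, by grind, by grind⟩⟩
  rintro s ⟨-, g₂, g₃, g₄, g₅, g₆⟩
  have g₀ : s 0 = n := by rw [g₄ _ (by omega), h0]
  refine Ensures.seq (T₁ := m * 5 + 4)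
    (T₂ := m * 5 + (n * m + 1) * 5 + (n * m * m + 1) * 5 + n * 5 + 22) ?_ (by omega)
  refine (Ensures.mul g₂ (by omega) (by omega) (by omega)).mono (by omega) ?_
  rintro s₁ ⟨a₁, a₁'⟩
  rw [g₀, g₃] at a₁
  refine Ensures.seq (T₁ := m * 5 + 4)
    (T₂ := (n * m + 1) * 5 + (n * m * m + 1) * 5 + n * 5 + 18) ?_ (by omega)
  refine (Ensures.mul (by grind) (by grind) (by omega) (by omega)).mono (by grind) ?_
  rintro s₂ ⟨a₂, a₂'⟩
  have b₁ : s₁ 1 = m := by grind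
  rw [a₁, b₁] at a₂
  have hs₂ : ∀ i, i < 6 ∨ 31 < i → s₂ i = s i := by grind
  have hs₂6 : s₂ 6 = n * m := by grind
  clear a₁ a₁' a₂' b₁
  refine add_seq fun x₂ hx₂ => add_seq fun x₃ hx₃ => ?_
  refine Ensures.seq (T₁ := (n * m + 1) * 5 + 4)
    (T₂ := (n * m * m + 1) * 5 + n * 5 + 12) ?_ (by omega)
  have e₂ : x₂ = n * m * m + 1 := by grind
  have e₃ : x₃ = n * m + 1 := by grind
  refine (Ensures.mul (by grind) (by grind) (by omega) (by omega)).mono (by grind) ?_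
  rintro s₃ ⟨a₃, a₃'⟩
  have hs₃ : ∀ i, i < 6 ∨ 31 < i → s₃ i = s i := by grind
  have hs₃8 : s₃ 8 = n * m * m + 1 := by grind
  have hs₃9 : s₃ 9 = (n + 1) ^ m * (n * m + 1) := by
    rw [a₃, Function.update_self, e₃, Function.update_of_ne (by omega),
      Function.update_of_ne (by omega), hs₂ _ (by omega), g₆]
  clear a₃ a₃' hx₂ hx₃ hs₂ hs₂6 a₂
  refine Ensures.seq (T₁ := (n * m * m + 1) * 5 + 4) (T₂ := n * 5 + 8) ?_ (by omega)
  refine (Ensures.mul (by grind) (by grind) (by omega) (by omega)).mono (by grind) ?_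
  rintro s₄ ⟨a₄, a₄'⟩
  rw [hs₃8, hs₃9] at a₄
  have hs₄ : ∀ i, i < 6 ∨ 31 < i → s₄ i = s i := by grind
  have hs₄9 : s₄ 9 = (n + 1) ^ m * (n * m + 1) := by grind
  clear a₄' hs₃ hs₃8 hs₃9
  refine Ensures.seq (T₁ := n * 5 + 4) (T₂ := 3 + 1) ?_ (by omega)
  refine (Ensures.mul (by grind) (by grind) (by omega) (by omega)).mono (by grind) ?_
  rintro s₅ ⟨a₅, a₅'⟩
  rw [hs₄ 0 (by omega), g₀, a₄, mul_comm] at a₅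
  have hs₅ : ∀ i, i < 6 ∨ 31 < i → s₅ i = s i := by grind
  have hs₅9 : s₅ 9 = (n + 1) ^ m * (n * m + 1) := by grind
  have hs₅10 : s₅ 10 = (n + 1) ^ m * (n * m + 1) * (n * m * m + 1) := by grind
  clear a₅' hs₄ hs₄9 a₄
  refine (add_seq fun x₄ hx₄ => add_seq fun x₅ hx₅ => store fun a x₆ ha hx₆ => ?_).mono
    (by omega) fun _ => id
  have e₄ : x₄ = (n + 1) * ((n + 1) ^ m * (n * m + 1) * (n * m * m + 1)) := by
    rw [hx₄, a₅, hs₅10]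
    ring
  have e₅ : x₅ = Y + m := by grind
  have ea : a = Y + m := by grind
  have e₆ : x₆ = 1 := by grind
  have hlow : ∀ i, i < 12 ∨ Y ≤ i → i ≠ Y + m →
      Function.update (Function.update (Function.update s₅ 12 x₄) 13 x₅) a x₆ i = s₅ i := by
    grind
  refine ⟨h.congr fun i hi => ?_, ⟨?_, ?_, ?_, ?_, ?_, ?_⟩, ?_, fun M => ?_⟩
  · rw [hlow i (by omega) (by omega), hs₅ i (by omega), g₄ i (by omega)]
  · rw [hlow _ (by omega) (by omega), hs₅ _ (by omega), g₅]
  · rw [hlow _ (by omega) (by omega), hs₅ _ (by omega), g₆]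
  · rw [hlow _ (by omega) (by omega), hs₅9]
  · rw [hlow _ (by omega) (by omega), hs₅10]
  · rw [hlow _ (by omega) (by omega), a₅]
  · rw [Function.update_of_ne (by omega), Function.update_of_ne (by omega), Function.update_self,
      e₄]
  · rw [Function.update_of_ne (by omega), Function.update_self, e₅]
  · by_cases hM : M = 0
    · subst hM
      simp [ea, e₆]
    · rw [hlow _ (by omega) (by omega), hs₅ _ (by omega), g₄ _ (by omega), hT _ (by omega)]
      simp [hM]

/-- Decide by dynamic programming whether the vector is a Borda score vector, and set register `7`
accordingly. -/
def Cmd.table : Cmd :=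
  .tableInit ;; .rows ;; .add 13 13 5 ;; .sub 13 13 3 ;; .load 7 13 ;; .sub 7 3 7 ;; .sub 7 3 7

/-- A bound for the running time of `Cmd.table`. -/
def tableTime (n m : ℕ) : ℕ :=
  (m * (n * 5 + 13) + m * 5 + m * 5 + (n * m + 1) * 5 + (n * m * m + 1) * 5 + n * 5 + 29) +
  (m * (n * ((n + 1) ^ m * (n * m + 1) * (n * m * m + 1)) * (m * (5 * n + 18) + 9) +
    (n + 1) ^ m * (n * m + 1) * 13 + 19) + 1 + 5)

theorem ensures_table {r : ℕ → ℕ} {y' : Fin m → ℕ} (hy : ∀ c : Fin m, y c = y' c)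
    (h : Holds n m Y y r) (hm : 1 ≤ m) (hn : 1 ≤ n)
    (hT : ∀ a, Y + m ≤ a → r a = 0) (hyle : ∀ c < m, y c ≤ n * m * m) :
    Ensures .table (tableTime n m) r fun r' => (IsBordaVector n y' → r' 7 = 1) ∧
      (¬ IsBordaVector n y' → r' 7 = 0) := by
  refine Ensures.seq ?_ le_rfl
  refine (ensures_tableInit h hm hn hT).mono le_rfl ?_
  rintro s ⟨g₁, g₂, g₃, g₄⟩
  have hpow : 1 ≤ (n + 1) ^ m := Nat.one_le_pow _ _ (by omega)
  refine Ensures.seq ?_ le_rfl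
  refine (ensures_rows g₁ g₂ g₃ hm hn ?_ ?_ (fun c hc => Nat.lt_succ_of_le (hyle c hc))
    g₄).mono le_rfl ?_
  -- The block size `(n + 1) ^ m * (n * m + 1)` leaves room for every code, because the entries of
  -- all rows together sum to `n * m`.
  · rw [mul_comm, mul_comm m n]
    exact Nat.mul_lt_mul_of_pos_left (Nat.lt_succ_self _) hpow
  · have := Nat.mul_le_mul_left (n * m) hm
    omega
  rintro s' ⟨k₁, k₂, k₃, -, k₅⟩
  refine add_seq fun x₁ hx₁ => sub_seq fun x₂ hx₂ => load_seq fun x₃ hx₃ => sub_seq fun x₄ hx₄ =>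
    sub fun x₅ hx₅ => ?_
  have e₁ : x₁ = s' 13 + (n + 1) ^ m := by rw [hx₁, k₂]
  have e₂ : x₂ = s' 13 + ((n + 1) ^ m - 1) := by
    have : x₂ = x₁ - 1 := by rw [hx₂, ← k₁]; simp
    omega
  have e₃ : x₃ = s' (s' 13 + ((n + 1) ^ m - 1)) := by
    rw [hx₃, Function.update_self, Function.update_of_ne (by omega),
      Function.update_of_ne (by omega), e₂]
  have hx := k₅ ((n + 1) ^ m - 1)
  rw [← e₃, ← isBordaVector_iff_mem_prefixCodes hy] at hx
  have e₄ : x₄ = 1 - x₃ := by rw [hx₄, ← k₁]; simp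
  have e₅ : x₅ = 1 - x₄ := by rw [hx₅, ← k₁]; simp
  -- The two subtractions compute `1 - (1 - x₃)`, which turns any nonzero count into `1`.
  rw [Function.update_self, ← hx]
  omega

/-! ### Moving the input out of the low registers -/

/-- Replace the registers `0` and `1` by independent linear combinations of them, the second of
which is an address outside of the input. -/
def Cmd.mix : Cmd :=
  .add 0 0 1 ;; .add 1 1 0 ;; .add 0 0 1 ;; .add 1 1 0 ;; .add 0 0 1 ;; .add 1 1 0 ;;
  .add 0 0 1 ;; .add 1 1 0

/-- The inverse of `Cmd.mix`. -/
def Cmd.unmix : Cmd :=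
  .sub 1 1 0 ;; .sub 0 0 1 ;; .sub 1 1 0 ;; .sub 0 0 1 ;; .sub 1 1 0 ;; .sub 0 0 1 ;;
  .sub 1 1 0 ;; .sub 0 0 1

/-- Copy the registers `2, …, k + 1` to the addresses that follow the address in register `1`. -/
def Cmd.saveLow : ℕ → Cmd
  | 0 => .const 0 1
  | k + 1 => .saveLow k ;; .add 1 1 0 ;; .store 1 (k + 2)

/-- Move the input out of the way, to have the first registers free for auxiliary values. -/
def Cmd.relocate : Cmd :=
  .mix ;; .store 1 0 ;; .saveLow 30 ;; .const 2 30 ;; .sub 1 1 2 ;; .load 0 1 ;;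
  .const 3 1 ;; .add 2 1 3 ;; .unmix ;;
  .const 5 32 ;; .const 6 30 ;; .add 6 6 2 ;;
  .forLoop 4 8 1 (.load 7 5 ;; .store 6 7 ;; .add 5 5 3 ;; .add 6 6 3)

theorem ensures_mix {r : ℕ → ℕ} {n m : ℕ} (h0 : r 0 = n) (h1 : r 1 = m) :
    Ensures .mix 8 r fun r' => r' 0 = 13 * n + 21 * m ∧ r' 1 = 21 * n + 34 * m ∧
      ∀ i, 2 ≤ i → r' i = r i := by
  refine add_seq fun x₁ hx₁ => add_seq fun x₂ hx₂ => add_seq fun x₃ hx₃ => add_seq fun x₄ hx₄ =>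
    add_seq fun x₅ hx₅ => add_seq fun x₆ hx₆ => add_seq fun x₇ hx₇ => add fun x₈ hx₈ => ?_
  simp only [Function.update_apply] at hx₁ hx₂ hx₃ hx₄ hx₅ hx₆ hx₇ hx₈
  simp at hx₁ hx₂ hx₃ hx₄ hx₅ hx₆ hx₇ hx₈
  refine ⟨?_, ?_, fun i hi => ?_⟩
  · simp
    omega
  · simp
    omega
  · have h0 : i ≠ 0 := by omega
    have h1 : i ≠ 1 := by omega
    simp [h0, h1]

theorem ensures_unmix {r : ℕ → ℕ} {n m : ℕ} (h0 : r 0 = 13 * n + 21 * m)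
    (h1 : r 1 = 21 * n + 34 * m) :
    Ensures .unmix 8 r fun r' => r' 0 = n ∧ r' 1 = m ∧ ∀ i, 2 ≤ i → r' i = r i := by
  refine sub_seq fun x₁ hx₁ => ?_
  replace hx₁ : x₁ = 8 * n + 13 * m := by omega
  refine sub_seq fun x₂ hx₂ => ?_
  simp at hx₂
  replace hx₂ : x₂ = 5 * n + 8 * m := by omega
  refine sub_seq fun x₃ hx₃ => ?_
  simp at hx₃
  replace hx₃ : x₃ = 3 * n + 5 * m := by omega
  refine sub_seq fun x₄ hx₄ => ?_
  simp at hx₄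
  replace hx₄ : x₄ = 2 * n + 3 * m := by omega
  refine sub_seq fun x₅ hx₅ => ?_
  simp at hx₅
  replace hx₅ : x₅ = n + 2 * m := by omega
  refine sub_seq fun x₆ hx₆ => ?_
  simp at hx₆
  replace hx₆ : x₆ = n + m := by omega
  refine sub_seq fun x₇ hx₇ => ?_
  simp at hx₇
  replace hx₇ : x₇ = m := by omega
  refine Ensures.sub fun x₈ hx₈ => ?_
  simp at hx₈
  replace hx₈ : x₈ = n := by omega
  refine ⟨?_, ?_, fun i hi => ?_⟩
  · simp
    omega
  · simp
    omega
  · have h0 : i ≠ 0 := by omega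
    have h1 : i ≠ 1 := by omega
    simp [h0, h1]

theorem ensures_saveLow {r : ℕ → ℕ} {A k : ℕ} (h1 : r 1 = A) (hA : k + 2 ≤ A) :
    Ensures (.saveLow k) (2 * k + 1) r fun r' => r' 0 = 1 ∧ r' 1 = A + k ∧
      (∀ i < k, r' (A + 1 + i) = r (i + 2)) ∧
      ∀ i, 2 ≤ i ∧ i ≤ A ∨ A + k < i → r' i = r i := by
  induction k with
  | zero =>
    refine const ⟨by simp, by simp [h1], by simp, fun i hi => ?_⟩
    rw [Function.update_of_ne (by omega)]
  | succ k ih =>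
    refine Ensures.seq (T₁ := 2 * k + 1) (T₂ := 2) ?_ (by omega)
    refine (ih (by omega)).mono le_rfl ?_
    rintro s ⟨g₀, g₁, g₂, g₃⟩
    refine add_seq fun x₁ hx₁ => store fun a x₂ ha hx₂ => ?_
    have e₁ : x₁ = A + k + 1 := by rw [hx₁, g₀, g₁]
    have e₂ : x₂ = r (k + 2) := by
      rw [hx₂, Function.update_of_ne (by omega), g₃ _ (by omega)]
    have ea : a = A + k + 1 := by rw [ha, Function.update_self, e₁]
    refine ⟨?_, ?_, fun i hi => ?_, fun i hi => ?_⟩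
    · rw [Function.update_of_ne (by omega), Function.update_of_ne (by omega), g₀]
    · rw [Function.update_of_ne (by omega), Function.update_self, e₁]
      ring
    · rcases Nat.lt_succ_iff_lt_or_eq.1 hi with h | rfl
      · rw [Function.update_of_ne (by omega), Function.update_of_ne (by omega), g₂ i h]
      · rw [show A + 1 + i = a by omega, Function.update_self, e₂]
    · rw [Function.update_of_ne (by omega), Function.update_of_ne (by omega), g₃ i (by omega)]

/-- For large `m` no auxiliary register at a fixed address is free at the start. The Fibonacci
mixing has determinant `13 * 34 - 21 * 21 = 1`, so it loses nothing, and it produces in place an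
address `A = 21 * n + 34 * m` beyond the input. One mixed value is stored at `A`, which frees
register `0`; the other is the pointer itself, recovered by subtracting `30` after the copy. -/
theorem ensures_relocate {y : Fin m → ℕ} {y' : ℕ → ℕ} (hm : 1 ≤ m)
    (hy : ∀ i, y' i = if h : i < m then y ⟨i, h⟩ else 0) :
    Ensures .relocate (m * 8 + 89) (input n y).reg fun r => ∃ Y, Holds n m Y y' r ∧
      ∀ a, Y + m ≤ a → r a = 0 := by
  have hin : ∀ i, (input n y).reg (i + 2) = y' i := fun i => (hy i).symm
  have hin0 : ∀ i, m + 2 ≤ i → (input n y).reg i = 0 := fun i hi => by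
    obtain ⟨i, rfl⟩ := Nat.exists_eq_add_of_le' (show 2 ≤ i by omega)
    rw [hin, hy, dif_neg (by omega)]
  have hy0 : ∀ i, m ≤ i → y' i = 0 := fun i hi => by rw [hy, dif_neg (by omega)]
  generalize hr : (input n y).reg = r at *
  set A := 21 * n + 34 * m with hA
  refine Ensures.seq (T₁ := 8) (T₂ := m * 8 + 81) ?_ (by omega)
  refine (ensures_mix (n := n) (m := m) (by rw [← hr]; rfl) (by rw [← hr]; rfl)).mono le_rfl ?_
  rintro s ⟨g₀, g₁, g₂⟩
  refine store_seq fun a x₁ ha hx₁ => ?_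
  rw [g₁] at ha
  rw [g₀] at hx₁
  subst ha
  -- The `30` saved registers `2, …, 31` cover all auxiliary registers used later; `61 = 2 * 30 +
  -- 1`.
  refine Ensures.seq (T₁ := 61) (T₂ := m * 8 + 19) ?_ (by omega)
  refine (ensures_saveLow (A := A) (k := 30) (by rw [Function.update_of_ne (by omega), g₁])
    (by omega)).mono le_rfl ?_
  rintro s₁ ⟨-, a₁, a₂, a₃⟩
  have a₄ : ∀ i < 30, s₁ (A + 1 + i) = y' i := fun i hi => by
    rw [a₂ i hi, Function.update_of_ne (by omega), g₂ _ (by omega), hin]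
  have a₅ : ∀ i, 2 ≤ i ∧ i < A ∨ A + 30 < i → s₁ i = r i := fun i hi => by
    rw [a₃ i (by omega), Function.update_of_ne (by omega), g₂ _ (by omega)]
  have a₆ : s₁ A = 13 * n + 21 * m := by
    rw [a₃ _ (by omega), Function.update_self, hx₁]
  clear a₂ a₃ g₀ g₁ g₂
  refine const_seq (sub_seq fun x₂ hx₂ => load_seq fun x₃ hx₃ => const_seq
    (add_seq fun x₄ hx₄ => ?_))
  have e₂ : x₂ = A := by
    rw [hx₂]
    simp [a₁]
  have e₃ : x₃ = 13 * n + 21 * m := by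
    rw [hx₃, Function.update_self, e₂, Function.update_of_ne (by omega),
      Function.update_of_ne (by omega), a₆]
  have e₄ : x₄ = A + 1 := by
    rw [hx₄]
    simp [e₂]
  set s₂ := Function.update (Function.update (Function.update (Function.update
    (Function.update s₁ 2 30) 1 x₂) 0 x₃) 3 1) 2 x₄ with hs₂
  have b₀ : s₂ 0 = 13 * n + 21 * m := by simp [hs₂, e₃]
  have b₁ : s₂ 1 = 21 * n + 34 * m := by simp [hs₂, e₂, hA]
  have b₂ : s₂ 2 = A + 1 := by simp [hs₂, e₄]
  have b₃ : s₂ 3 = 1 := by simp [hs₂]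
  have b₄ : ∀ i, 4 ≤ i → s₂ i = s₁ i := fun i hi => by
    rw [hs₂, Function.update_of_ne (by omega), Function.update_of_ne (by omega),
      Function.update_of_ne (by omega), Function.update_of_ne (by omega),
      Function.update_of_ne (by omega)]
  clear_value s₂
  refine Ensures.seq (T₁ := 8) (T₂ := m * 8 + 4) ?_ (by omega)
  refine (ensures_unmix b₀ b₁).mono le_rfl ?_
  rintro s₃ ⟨c₀, c₁, c₂⟩
  rw [← c₂ _ (by omega)] at b₂ b₃
  have c₄ : ∀ i < 30, s₃ (A + 1 + i) = y' i := fun i hi => by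
    rw [c₂ _ (by omega), b₄ _ (by omega), a₄ i hi]
  have c₅ : ∀ i, 4 ≤ i ∧ i < A ∨ A + 30 < i → s₃ i = r i := fun i hi => by
    rw [c₂ _ (by omega), b₄ _ (by omega), a₅ i (by omega)]
  clear c₂ b₄ a₄ a₅
  refine const_seq (const_seq (add_seq fun x₅ hx₅ => ?_))
  have e₅ : x₅ = A + 31 := by
    rw [hx₅]
    simp [b₂]
    omega
  refine (forLoop (T := 4) (N := m) (I := fun k s => s 0 = n ∧ s 2 = A + 1 ∧
    s 5 = 32 + k ∧ s 6 = A + 31 + k ∧ (∀ i < 30 + k, s (A + 1 + i) = y' i) ∧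
    ∀ i, 32 ≤ i ∧ i < A ∨ A + 30 + k < i → s i = r i) hm (by simp [b₃]) (by simp [c₁])
    ⟨by simp [c₀], by simp [b₂], by simp, by simp [e₅], fun i hi => ?_, fun i hi => ?_⟩ ?_).mono
    (by omega) ?_
  · rw [Function.update_of_ne (by omega), Function.update_of_ne (by omega),
      Function.update_of_ne (by omega), Function.update_of_ne (by omega), c₄ i hi]
  · rw [Function.update_of_ne (by omega), Function.update_of_ne (by omega),
      Function.update_of_ne (by omega), Function.update_of_ne (by omega), c₅ i (by omega)]
  · rintro k hk s g₁ g₂ g₃ ⟨k₁, k₂, k₃, k₄, k₅, k₆⟩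
    refine load_seq fun x₁ hx₁ => store_seq fun a x₂ ha hx₂ => add_seq fun x₃ hx₃ =>
      add fun x₄ hx₄ => ?_
    have e₁ : x₁ = y' (30 + k) := by
      rw [hx₁, k₃, k₆ _ (by omega), ← hin]
      congr 1
      ring
    have ea : a = A + 31 + k := by rw [ha, Function.update_of_ne (by omega), k₄]
    have e₂ : x₂ = y' (30 + k) := by rw [hx₂, Function.update_self, e₁]
    have e₃ : x₃ = 32 + (k + 1) := by
      rw [hx₃, Function.update_of_ne (by omega), Function.update_of_ne (by omega),
        Function.update_of_ne (by omega), Function.update_of_ne (by omega), k₃, g₂, add_assoc]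
    have e₄ : x₄ = A + 31 + (k + 1) := by
      rw [hx₄, Function.update_of_ne (by omega), Function.update_of_ne (by omega),
        Function.update_of_ne (by omega), Function.update_of_ne (by omega),
        Function.update_of_ne (by omega), Function.update_of_ne (by omega), k₄, g₂, add_assoc]
    have hlow : ∀ i, i < 5 ∨ 8 < i → i ≠ a → Function.update (Function.update (Function.update
        (Function.update s 7 x₁) a x₂) 5 x₃) 6 x₄ i = s i := fun i hi hia => by
      rw [Function.update_of_ne (by omega), Function.update_of_ne (by omega),
        Function.update_of_ne hia, Function.update_of_ne (by omega)]
    refine ⟨by rw [hlow _ (by omega) (by omega), g₁], by rw [hlow _ (by omega) (by omega), g₂],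
      by rw [hlow _ (by omega) (by omega), g₃], fun x => ⟨?_, ?_, ?_, ?_, fun i hi => ?_,
        fun i hi => ?_⟩⟩
    · rw [Function.update_of_ne (by omega), Function.update_of_ne (by omega),
        hlow _ (by omega) (by omega), k₁]
    · rw [Function.update_of_ne (by omega), Function.update_of_ne (by omega),
        hlow _ (by omega) (by omega), k₂]
    · simp [e₃]
    · simp [e₄]
    · rw [Function.update_of_ne (by omega), Function.update_of_ne (by omega)]
      by_cases h : i = 30 + k
      · rw [Function.update_of_ne (by omega), Function.update_of_ne (by omega),
          show A + 1 + i = a by omega, Function.update_self, e₂, h]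
      · rw [hlow _ (by omega) (by omega), k₅ i (by omega)]
    · rw [Function.update_of_ne (by omega), Function.update_of_ne (by omega),
        hlow _ (by omega) (by omega), k₆ i (by omega)]
  · rintro s ⟨-, g₂, g₃, k₁, k₂, -, -, k₅, k₆⟩
    refine ⟨A + 1, ⟨k₁, g₃, k₂, g₂, by omega, fun c hc => k₅ c (by omega)⟩, fun a ha => ?_⟩
    rcases lt_or_ge (A + 30 + m) a with h | h
    · rw [k₆ a (by omega), hin0 a (by omega)]
    · obtain ⟨i, rfl⟩ := Nat.exists_eq_add_of_le (show A + 1 ≤ a by omega)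
      rw [k₅ i (by omega), hy0 i (by omega)]

/-! ### The decision procedure and its running time -/

/-- The exponent `8` comes from the dominant product: `m` rows, `n * m + 1 ≤ 2 * m ^ 2` and `n * m *
m + 1 ≤ 2 * m ^ 3` for the size of a layer, and `32 * m ^ 2` for a visit. -/
theorem tableTime_le {n m : ℕ} (hn : 1 ≤ n) (hnm : n ≤ m) :
    tableTime n m ≤ 400 * (n * (n + 1) ^ m * m ^ 8) := by
  have hm : 1 ≤ m := hn.trans hnm
  have hp : 1 ≤ (n + 1) ^ m := Nat.one_le_pow _ _ (by omega)
  unfold tableTime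
  generalize (n + 1) ^ m = p at *
  have h₁ : n * m + 1 ≤ 2 * m ^ 2 := by nlinarith
  have h₂ : n * m * m + 1 ≤ 2 * m ^ 3 := by
    have : n * m * m ≤ m * m * m := by gcongr
    have : 1 ≤ m ^ 3 := Nat.one_le_pow _ _ hm
    nlinarith
  have h₃ : m * (5 * n + 18) + 9 ≤ 32 * m ^ 2 := by nlinarith
  have hq : ∀ e ≤ 8, m ^ e ≤ n * p * m ^ 8 := fun e he =>
    calc m ^ e ≤ m ^ 8 := Nat.pow_le_pow_right hm he
      _ ≤ n * p * m ^ 8 := Nat.le_mul_of_pos_left _ (by positivity)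
  have q₀ := hq 0 (by omega)
  have q₁ := hq 1 (by omega)
  have q₂ := hq 2 (by omega)
  have q₃ := hq 3 (by omega)
  have t₁ : m * (n * 5 + 13) ≤ 18 * m ^ 2 := by nlinarith
  have t₂ : m * (n * (p * (n * m + 1) * (n * m * m + 1)) * (m * (5 * n + 18) + 9)) ≤
      128 * (n * p * m ^ 8) := by
    calc _ ≤ m * (n * (p * (2 * m ^ 2) * (2 * m ^ 3)) * (32 * m ^ 2)) := by gcongr
      _ = _ := by ring
  have t₃ : m * (p * (n * m + 1) * 13) ≤ 26 * (n * p * m ^ 8) := by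
    calc _ ≤ m * (p * (2 * m ^ 2) * 13) := by gcongr
      _ = 26 * (1 * p * m ^ 3) := by ring
      _ ≤ _ := by gcongr; omega
  rw [show ∀ a b, m * (a + b + 19) = m * a + m * b + m * 19 by intros; ring]
  generalize n * p * m ^ 8 = q at *
  simp only [pow_zero, pow_one] at q₀ q₁
  omega

/-- The decision procedure. -/
def Cmd.decideBorda : Cmd :=
  .cond 1 (.relocate ;; .hinge ;;
    .cond 7 (.cond 0 (.add 8 1 3 ;; .sub 8 8 0 ;; .cond 8 .table)) ;;
    .const 0 0 ;; .add 0 0 7 ;; .const 1 1) ;;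
  .const 2 1 ;; .sub 2 2 1 ;; .cond 2 (.const 0 1)

/-- A bound for the running time of the decision procedure. -/
def decideTime (n m : ℕ) : ℕ :=
  (m * 8 + 89) + (m * (m * 9 + 11) + 10) + (if n ≤ m then tableTime n m else 0) + 13

open Classical in
theorem ensures_decideBorda (y : Fin m → ℕ) :
    Ensures .decideBorda (decideTime n m) (input n y).reg fun r =>
      r 0 = if IsBordaVector n y then 1 else 0 := by
  set T := if n ≤ m then tableTime n m else 0 with hT
  refine Ensures.seq (T₁ := (m * 8 + 89) + (m * (m * 9 + 11) + 10) + T + 9) (T₂ := 4) ?_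
    (by unfold decideTime; omega)
  refine Ensures.cond (T := (m * 8 + 89) + (m * (m * 9 + 11) + 10) + T + 8) (fun h => ?_)
    fun h => ?_
  -- Without candidates the answer is always yes; the test at the end of the program recognizes this
  -- case by register `1` being zero.
  · obtain rfl : m = 0 := h
    refine const_seq (sub_seq fun x hx => Ensures.cond (fun h' => ?_) fun _ => const ?_)
    · have h : (input n y).reg 1 = 0 := rfl
      simp [hx, h] at h'
    · have : IsBordaVector n y := ⟨fun _ => 1, Subsingleton.elim _ _⟩
      simp [this]
  · have hm : 1 ≤ m := Nat.one_le_iff_ne_zero.2 h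
    let y' : ℕ → ℕ := fun i => if h : i < m then y ⟨i, h⟩ else 0
    have hy : ∀ c : Fin m, y' c = y c := fun c => by simp [y']
    refine Ensures.seq (T₁ := m * 8 + 89) (T₂ := (m * (m * 9 + 11) + 10) + T + 8) ?_ (by omega)
    refine (ensures_relocate (n := n) (y := y) (y' := y') hm fun i => rfl).mono le_rfl ?_
    rintro r ⟨Y, hr, hr0⟩
    refine Ensures.seq (T₁ := m * (m * 9 + 11) + 10) (T₂ := T + 8) ?_ (by omega)
    refine (ensures_hinge hy hr hm).mono le_rfl ?_
    rintro s ⟨hs, hsr, hs₁, hs₂⟩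
    have hle := hr.le
    refine Ensures.seq (T₁ := T + 3 + 1 + 1) (T₂ := 3) ?_ (by omega)
    have key : Ensures (.cond 7 (.cond 0 (.add 8 1 3 ;; .sub 8 8 0 ;; .cond 8 .table)))
        (T + 3 + 1 + 1) s fun r' => r' 7 = if IsBordaVector n y then 1 else 0 := by
      refine Ensures.cond (fun h₇ => ?_) fun h₇ => Ensures.cond (fun h₀ => ?_) fun h₀ => ?_
      · rw [h₇, if_neg]
        intro hB
        have := hs₁ hB.hinge
        omega
      · have hH : Hinge n y := by
          by_contra hH
          exact h₇ (hs₂ hH)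
        have hn : n = 0 := by rw [← hs.zero, h₀]
        rw [hs₁ hH, if_pos]
        rw [hn] at hH ⊢
        exact isBordaVector_zero_iff.2 hH
      · have hH : Hinge n y := by
          by_contra hH
          exact h₇ (hs₂ hH)
        have hn : 1 ≤ n := by
          have := hs.zero
          omega
        refine add_seq fun x₁ hx₁ => sub_seq fun x₂ hx₂ => Ensures.cond (fun h₈ => ?_) fun h₈ => ?_
        · have : x₂ = m + 1 - n := by
            rw [hx₂, ← hs.one, ← hs.zero]
            simp [hx₁, hs.three]
          rw [Function.update_self] at h₈
          rw [Function.update_of_ne (by omega), Function.update_of_ne (by omega), hs₁ hH, if_pos]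
          exact hH.isBordaVector (by omega)
        · have : x₂ = m + 1 - n := by
            rw [hx₂, ← hs.one, ← hs.zero]
            simp [hx₁, hs.three]
          rw [Function.update_self] at h₈
          have hnm : n ≤ m := by omega
          have hup : ∀ i, i < 8 ∨ 8 < i →
              Function.update (Function.update s 8 x₁) 8 x₂ i = s i := fun i hi => by
            rw [Function.update_of_ne (by omega), Function.update_of_ne (by omega)]
          -- The table is entered only after the inequalities have been checked; their sum condition
          -- bounds the entries of `y`, so that the scores fit into a layer.
          have hyle : ∀ c < m, y' c ≤ n * m * m := fun c hc => by
            have h₁ := ((hinge_iff_range hy).1 hH).2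
            have h₂ := Finset.single_le_sum (f := y') (fun _ _ => Nat.zero_le _)
              (Finset.mem_range.2 hc)
            have h₃ : ∑ i ∈ Finset.range m, i ≤ m * m := by
              have := Finset.sum_range_id_mul_two m
              have := Nat.mul_le_mul_left m (Nat.sub_le m 1)
              omega
            have h₄ := Nat.mul_le_mul_left n h₃
            rw [← mul_assoc] at h₄
            omega
          rw [hT, if_pos hnm]
          refine (ensures_table hy (hs.congr fun i hi => hup i (by omega)) hm hn (fun a ha => ?_)
            hyle).mono le_rfl ?_
          · rw [hup a (by omega), hsr a (by omega), hr0 a ha]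
          · rintro r' ⟨h₁, h₂⟩
            split_ifs with hB
            · exact h₁ hB
            · exact h₂ hB
    refine key.mono le_rfl fun s' hs' => ?_
    -- Register `1` is set to `1` so that the final test for `m = 0` leaves the answer alone.
    refine const_seq (add_seq fun x₁ hx₁ => const ?_)
    refine (const_seq (sub_seq fun x₂ hx₂ => Ensures.cond (T := 1) (fun _ => ?_) fun h' => ?_)).mono
      le_rfl fun _ => id
    · simpa [hx₁] using hs'
    · simp [hx₂] at h'

/-- One factor `m ^ m` pays for the codes, the other for `m ^ 8`. The linear and quadratic terms are
at most `140 * m ^ 2`. -/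
theorem decideTime_le (hm : 1 ≤ m) (hn : 1 ≤ n) :
    decideTime n m ≤ (1200 * 8 ^ 8 + 140) * (m ^ (2 * m + 1) * n) := by
  have h₁ : m ^ 2 ≤ m ^ (2 * m + 1) * n :=
    (Nat.pow_le_pow_right hm (by omega)).trans (Nat.le_mul_of_pos_right _ hn)
  have h₂ : (if n ≤ m then tableTime n m else 0) ≤ 1200 * 8 ^ 8 * (m ^ (2 * m + 1) * n) := by
    split_ifs with h
    · calc tableTime n m ≤ 400 * (n * (n + 1) ^ m * m ^ 8) := tableTime_le hn h
        _ ≤ 400 * (n * (m + 1) ^ m * m ^ 8) := by gcongr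
        _ ≤ 400 * (n * (3 * m ^ m) * (8 ^ 8 * m ^ m)) := by
            gcongr
            · exact succ_pow_self_le m
            · exact pow_le_const_mul_pow_self 8 m hm
        _ = 1200 * 8 ^ 8 * (m ^ (2 * m) * n) := by rw [two_mul, pow_add]; ring
        _ ≤ 1200 * 8 ^ 8 * (m ^ (2 * m + 1) * n) := by
            gcongr
            omega
    · exact Nat.zero_le _
  have h₃ : m ≤ m ^ 2 := Nat.le_self_pow (by omega) m
  unfold decideTime
  rw [add_mul, show m * (m * 9 + 11) = 9 * m ^ 2 + 11 * m by ring]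
  omega

end RAM

open Classical in
theorem proposition2 :
    ∃ (P : RAM.Program) (K : ℕ), ∀ (m n : ℕ) (y : Fin m → ℕ), ∃ t : ℕ,
      P.Outputs (RAM.input n y) t (if IsBordaVector n y then 1 else 0) ∧
        (1 ≤ m → 1 ≤ n → t ≤ K * (m ^ (2 * m + 1) * n)) := by
  refine ⟨RAM.Cmd.decideBorda.compile 0, 1200 * 8 ^ 8 + 140, fun m n y => ?_⟩
  obtain ⟨t, r, ht, hr, hQ⟩ := RAM.ensures_decideBorda (n := n) y
  have h := hr.iterate_step (P := RAM.Cmd.decideBorda.compile 0) (a := 0) ⟨[], [], by simp, rfl⟩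
  refine ⟨t, ⟨?_, ?_⟩, fun hm hn => ht.trans (RAM.decideTime_le hm hn)⟩
  · change RAM.Program.Halted _ ((RAM.Program.step _)^[t] ⟨0, (RAM.input n y).reg⟩)
    rw [h, RAM.Program.Halted, RAM.Cmd.length_compile]
    simp
  · change ((RAM.Program.step _)^[t] ⟨0, (RAM.input n y).reg⟩).reg 0 = _
    rw [h]
    exact hQ
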